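/- For a group $X$, the commuting graph $\Gamma(X)$ has the non-central elements of $X$ as vertices, two distinct vertices being adjacent if and only if they commute; $\mathrm d$ denotes the distance in this graph. Let $q$ be a power of an odd prime, let $r\ge 5$ be a prime such that $r\mid q-1$ and $r^2\nmid q-1$, and let $t$ be a prime with $t\mid (q^r-1)/(q-1)$ and $t\nmid q-1$. Let $\mathbb F=\mathrm{GF}(q^r)$ and let $\beta\colon a\mapsto a^q$, an automorphism of $\mathbb F$ of order $r$. Put $$J=\begin{pmatrix}0&0&0&1\\0&0&1&0\\0&-1&0&0\\-1&0&0&0\end{pmatrix},\qquad H=\mathrm{Sp}_4(\mathbb F)=\{A\in \mathrm{GL}_4(\mathbb F): AJA^{T}=J\},$$ $$F=\left\{\begin{pmatrix}1&0&0&0\\a&1&0&0\\b&s&1&0\\c&d&-a&1\end{pmatrix}: a,b,c,d,s\in\mathbb F,\ sa=b-d\right\}\le H .$$ Let $\delta,\varepsilon\in\mathbb F^\times$ be elements of order $r^2$ such that the set $\{\delta^r,\delta^{-r},\varepsilon^r,\varepsilon^{-r}\}$ has four elements, and let $\varphi\in\mathbb F^\times$ have order $t$ (such $\delta,\varepsilon,\varphi$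 exist). Put $z=\mathrm{diag}(\delta,\varepsilon,\varepsilon^{-1},\delta^{-1})$ and $c=\mathrm{diag}(\varphi,\varphi,\varphi^{-1},\varphi^{-1})$, and work in the semidirect product $H\rtimes\langle\beta\rangle$, where $\beta^{-1}h\beta$ is obtained by applying $\beta$ to the entries of $h\in H$. Let $x=z\beta$, $D=\langle x,c\rangle$, and $$g=\begin{pmatrix}1&0&0&0\\0&1&0&0\\1&1&1&0\\0&1&0&1\end{pmatrix}\in F,\qquad y=x^g=g^{-1}xg .$$ Then $D$ is metacyclic of order $r^2t$, $D$ normalizes $F$, $F\cap D=1$, and $G=FD=F\rtimes D$ is a finite soluble group of order $q^{4r}r^2t$ with trivial centre. Moreover $\mathrm d(x,y)=8$ in $\Gamma(G)$, and $\Gamma(G)$ is connected of diameter exactly $8$. In particular, $q=11$, $r=5$, $t=3221$ satisfy the conditions above, so there is an explicit finite soluble group with trivial centre, of order $11^{20}\cdot 5^2\cdot 3221$, whose commuting graph is connected of diameter exactly $8$; hence the upper bound $8$ for the diameter of a connected commuting graph of a finite soluble group with trivial centre is attained. -/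

import Mathlib

open scoped Matrix

namespace CommutingDiameter

/-- The commuting graph of a group: the vertices are the non-central elements, and two distinct
vertices are adjacent if and only if they commute. -/
def commutingGraph (G : Type*) [Group G] : SimpleGraph {g : G // g ∉ Subgroup.center G} where
  Adj a b := a ≠ b ∧ (a : G) * b = b * a
  symm := ⟨fun _ _ h => ⟨h.1.symm, h.2.symm⟩⟩
  loopless := ⟨fun _ h => h.1 rfl⟩

/-- A group is metacyclic if it has a cyclic normal subgroup with cyclic quotient. -/
def IsMetacyclic (G : Type*) [Group G] : Prop :=
  ∃ (N : Subgroup G) (_ : N.Normal), IsCyclic N ∧ IsCyclic (G ⧸ N)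

/-- The numerical conditions: `r ≥ 5` is a prime which divides `q - 1` exactly (that is, `r` divides
`q - 1` and `r ^ 2` does not), and `t` is a prime which divides `(q ^ r - 1) / (q - 1)` but does not
divide `q - 1`. -/
structure IsParameters (q r t : ℕ) : Prop where
  prime_r : r.Prime
  five_le : 5 ≤ r
  r_dvd : r ∣ q - 1
  not_sq_dvd : ¬ r ^ 2 ∣ q - 1
  prime_t : t.Prime
  t_dvd : t ∣ (q ^ r - 1) / (q - 1)
  t_not_dvd : ¬ t ∣ q - 1

section Symplectic

variable {K : Type*} [Field K]

/-- The matrix of the alternating form. -/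
def formJ (K : Type*) [Field K] : Matrix (Fin 4) (Fin 4) K :=
  !![0, 0, 0, 1;
     0, 0, 1, 0;
     0, -1, 0, 0;
     -1, 0, 0, 0]

/-- The symplectic group of all invertible `A` with `A J Aᵀ = J`. -/
def Sp4 (K : Type*) [Field K] : Subgroup (GL (Fin 4) K) where
  carrier := {A | (A : Matrix (Fin 4) (Fin 4) K) * formJ K * (A : Matrix (Fin 4) (Fin 4) K)ᵀ
    = formJ K}
  mul_mem' := by
    intro A B hA hB
    simp only [Set.mem_ofPred_eq] at hA hB ⊢
    calc ((A * B : GL (Fin 4) K) : Matrix (Fin 4) (Fin 4) K) * formJ K *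
          ((A * B : GL (Fin 4) K) : Matrix (Fin 4) (Fin 4) K)ᵀ
        = (A : Matrix (Fin 4) (Fin 4) K) * ((B : Matrix (Fin 4) (Fin 4) K) * formJ K *
          (B : Matrix (Fin 4) (Fin 4) K)ᵀ) * (A : Matrix (Fin 4) (Fin 4) K)ᵀ := by
          rw [Units.val_mul, Matrix.transpose_mul]
          simp only [Matrix.mul_assoc]
      _ = formJ K := by rw [hB, hA]
  one_mem' := by simp
  inv_mem' := by
    intro A hA
    simp only [Set.mem_ofPred_eq] at hA ⊢
    have h1 : ((A⁻¹ : GL (Fin 4) K) : Matrix (Fin 4) (Fin 4) K) *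
        (A : Matrix (Fin 4) (Fin 4) K) = 1 := by
      rw [← Units.val_mul, inv_mul_cancel, Units.val_one]
    have h2 : (A : Matrix (Fin 4) (Fin 4) K)ᵀ *
        ((A⁻¹ : GL (Fin 4) K) : Matrix (Fin 4) (Fin 4) K)ᵀ = 1 := by
      rw [← Matrix.transpose_mul, h1, Matrix.transpose_one]
    calc ((A⁻¹ : GL (Fin 4) K) : Matrix (Fin 4) (Fin 4) K) * formJ K *
          ((A⁻¹ : GL (Fin 4) K) : Matrix (Fin 4) (Fin 4) K)ᵀ
        = (((A⁻¹ : GL (Fin 4) K) : Matrix (Fin 4) (Fin 4) K) * (A : Matrix (Fin 4) (Fin 4) K)) *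
          formJ K * ((A : Matrix (Fin 4) (Fin 4) K)ᵀ *
          ((A⁻¹ : GL (Fin 4) K) : Matrix (Fin 4) (Fin 4) K)ᵀ) := by
          conv_lhs => rw [← hA]
          simp only [Matrix.mul_assoc]
      _ = formJ K := by rw [h1, h2, Matrix.one_mul, Matrix.mul_one]

/-- The underlying matrix of a symplectic group element. -/
def mat (A : Sp4 K) : Matrix (Fin 4) (Fin 4) K := ((A : GL (Fin 4) K) : Matrix _ _ K)

theorem mat_injective : Function.Injective (mat (K := K)) := fun _ _ h =>
  Subtype.ext (Units.ext h)

theorem mat_mul (A B : Sp4 K) : mat (A * B) = mat A * mat B := rfl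

theorem mat_one : mat (1 : Sp4 K) = 1 := rfl

/-- A matrix with a given right inverse which preserves the form, as a symplectic group element. -/
def Sp4.mk (A B : Matrix (Fin 4) (Fin 4) K) (hAB : A * B = 1) (hA : A * formJ K * Aᵀ = formJ K) :
    Sp4 K :=
  ⟨⟨A, B, hAB, mul_eq_one_comm.mp hAB⟩, hA⟩

/-- The diagonal element `diag(d, e, e⁻¹, d⁻¹)`. -/
def diagSp (d e : Kˣ) : Sp4 K :=
  Sp4.mk
    (Matrix.diagonal ![(d : K), (e : K), ((e⁻¹ : Kˣ) : K), ((d⁻¹ : Kˣ) : K)])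
    (Matrix.diagonal ![((d⁻¹ : Kˣ) : K), ((e⁻¹ : Kˣ) : K), (e : K), (d : K)])
    (by
      rw [Matrix.diagonal_mul_diagonal, ← Matrix.diagonal_one]
      congr 1
      funext i
      fin_cases i <;> simp)
    (by
      ext i j
      fin_cases i <;> fin_cases j <;>
        simp [formJ, Matrix.mul_apply, Matrix.diagonal])

/-- The general lower unitriangular matrix occurring in the unipotent subgroup. -/
def lowerMat (a b c d x : K) : Matrix (Fin 4) (Fin 4) K :=
  !![1, 0, 0, 0;
     a, 1, 0, 0;
     b, x, 1, 0;
     c, d, -a, 1]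

theorem lowerMat_mul (a b c d x a' b' c' d' x' : K) :
    lowerMat a b c d x * lowerMat a' b' c' d' x' =
      !![1, 0, 0, 0;
         a + a', 1, 0, 0;
         b + x * a' + b', x + x', 1, 0;
         c + d * a' - a * b' + c', d - a * x' + d', -a - a', 1] := by
  ext i j
  fin_cases i <;> fin_cases j <;>
    simp [lowerMat, Matrix.mul_apply, Fin.sum_univ_four] <;> ring

theorem lowerMat_mul_inv {a b c d x : K} (h : x * a = b - d) :
    lowerMat a b c d x * lowerMat (-a) (-d) (-c) (-b) (-x) = 1 := by
  have hb : b = x * a + d := by rw [h]; ring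
  subst hb
  rw [lowerMat_mul]
  ext i j
  fin_cases i <;> fin_cases j <;> simp <;> ring

/-- The unipotent subgroup `F` of the symplectic group: all matrices of the above lower triangular
shape with `x a = b - d` (which is the condition for such a matrix to be symplectic). -/
def unipotentF (K : Type*) [Field K] : Subgroup (Sp4 K) where
  carrier := {A | ∃ a b c d x : K, x * a = b - d ∧ mat A = lowerMat a b c d x}
  mul_mem' := by
    rintro A B ⟨a, b, c, d, x, h, hA⟩ ⟨a', b', c', d', x', h', hB⟩
    refine ⟨a + a', b + x * a' + b', c + d * a' - a * b' + c', d - a * x' + d', x + x', ?_, ?_⟩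
    · linear_combination h + h'
    · rw [mat_mul, hA, hB, lowerMat_mul, lowerMat, neg_add']
  one_mem' := by
    refine ⟨0, 0, 0, 0, 0, by simp, ?_⟩
    rw [mat_one]
    ext i j
    fin_cases i <;> fin_cases j <;> simp [lowerMat]
  inv_mem' := by
    rintro A ⟨a, b, c, d, x, h, hA⟩
    refine ⟨-a, -d, -c, -b, -x, by linear_combination h, ?_⟩
    have h1 : mat A⁻¹ * mat A = 1 := by rw [← mat_mul, inv_mul_cancel, mat_one]
    have h2 := lowerMat_mul_inv (c := c) h
    rw [← hA] at h2
    calc mat A⁻¹ = mat A⁻¹ * (mat A * lowerMat (-a) (-d) (-c) (-b) (-x)) := by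
          rw [h2, Matrix.mul_one]
      _ = lowerMat (-a) (-d) (-c) (-b) (-x) := by rw [← Matrix.mul_assoc, h1, Matrix.one_mul]

/-- The element `g` of the unipotent subgroup. -/
def gSp (K : Type*) [Field K] : Sp4 K :=
  Sp4.mk
    !![1, 0, 0, 0;
       0, 1, 0, 0;
       1, 1, 1, 0;
       0, 1, 0, 1]
    !![1, 0, 0, 0;
       0, 1, 0, 0;
       -1, -1, 1, 0;
       0, -1, 0, 1]
    (by
      ext i j
      fin_cases i <;> fin_cases j <;> simp [Matrix.mul_apply, Fin.sum_univ_four])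
    (by
      ext i j
      fin_cases i <;> fin_cases j <;>
        simp [formJ, Matrix.mul_apply, Fin.sum_univ_four])

theorem gSp_mem (K : Type*) [Field K] : gSp K ∈ unipotentF K := by
  refine ⟨0, 1, 0, 1, 1, by simp, ?_⟩
  simp [gSp, Sp4.mk, mat, lowerMat]

/-- A field automorphism applied to all entries of the matrices in the symplectic group. -/
def entrywise : RingAut K →* MulAut (Sp4 K) :=
  have key : ∀ (σ : RingAut K) (A : Sp4 K),
      Matrix.GeneralLinearGroup.map (σ : K →+* K) (A : GL (Fin 4) K) ∈ Sp4 K := by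
    intro σ A
    have hJ : (formJ K).map σ = formJ K := by
      ext i j
      fin_cases i <;> fin_cases j <;> simp [formJ]
    have hA : mat A * formJ K * (mat A)ᵀ = formJ K := A.2
    have := congrArg (fun M : Matrix (Fin 4) (Fin 4) K => M.map σ) hA
    simp only [Matrix.map_mul, hJ, Matrix.transpose_map] at this
    exact this
  { toFun := fun σ =>
      { toFun := fun A => ⟨Matrix.GeneralLinearGroup.map (σ : K →+* K) (A : GL (Fin 4) K), key σ A⟩
        invFun := fun A => ⟨Matrix.GeneralLinearGroup.map ((σ⁻¹ : RingAut K) : K →+* K)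
          (A : GL (Fin 4) K), key σ⁻¹ A⟩
        left_inv := fun A => by
          apply Subtype.ext; ext i j
          exact σ.symm_apply_apply _
        right_inv := fun A => by
          apply Subtype.ext; ext i j
          exact σ.apply_symm_apply _
        map_mul' := fun A B => by
          apply Subtype.ext
          simp }
    map_one' := by
      ext A i j
      rfl
    map_mul' := fun σ τ => by
      ext A i j
      rfl }

/-- The action defining the semidirect product. Conjugation is `h ^ β = β⁻¹ h β`, and `h ^ β` is `β`
applied to the entries of `h`; hence `β h β⁻¹` is `β⁻¹` applied to the entries of `h`. -/
def semidirectAction (β : RingAut K) : Subgroup.zpowers β →* MulAut (Sp4 K) where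
  toFun σ := entrywise (σ : RingAut K)⁻¹
  map_one' := by simp
  map_mul' σ τ := by
    have h : (σ : RingAut K) * τ = τ * σ := congrArg Subtype.val (mul_comm' σ τ)
    rw [Subgroup.coe_mul, h, mul_inv_rev, map_mul]

/-- The semidirect product of the symplectic group with the group generated by the field
automorphism `β`. -/
abbrev Ambient (β : RingAut K) : Type _ := Sp4 K ⋊[semidirectAction β] Subgroup.zpowers β

/-- The element `β` of the semidirect product. -/
def betaElt (β : RingAut K) : Ambient β :=
  SemidirectProduct.inr ⟨β, Subgroup.mem_zpowers β⟩

theorem betaElt_conj (β : RingAut K) (h : Sp4 K) :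
    (betaElt β)⁻¹ * SemidirectProduct.inl h * betaElt β =
      (SemidirectProduct.inl (entrywise β h) : Ambient β) := by
  have := SemidirectProduct.inl_aut_inv (φ := semidirectAction β) ⟨β, Subgroup.mem_zpowers β⟩ h
  rw [← map_inv (semidirectAction β)] at this
  simp only [betaElt]
  rw [← map_inv, ← this]
  simp [semidirectAction]

/-- The subgroup `F`, inside the semidirect product. -/
def subF (β : RingAut K) : Subgroup (Ambient β) :=
  (unipotentF K).map SemidirectProduct.inl

/-- The element `x = z β` with `z = diag(d, e, e⁻¹, d⁻¹)`. -/
def xElt (β : RingAut K) (d e : Kˣ) : Ambient β :=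
  SemidirectProduct.inl (diagSp d e) * betaElt β

/-- The element `c = diag(f, f, f⁻¹, f⁻¹)`. -/
def cElt (β : RingAut K) (f : Kˣ) : Ambient β :=
  SemidirectProduct.inl (diagSp f f)

/-- The element `g`. -/
def gElt (β : RingAut K) : Ambient β := SemidirectProduct.inl (gSp K)

/-- The subgroup `D = ⟨x, c⟩`. -/
def subD (β : RingAut K) (d e f : Kˣ) : Subgroup (Ambient β) :=
  Subgroup.closure {xElt β d e, cElt β f}

/-- The group `G = ⟨F, D⟩`. -/
def groupG (β : RingAut K) (d e f : Kˣ) : Subgroup (Ambient β) :=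
  subF β ⊔ subD β d e f

/-- The element `x` of `G`. -/
def xG (β : RingAut K) (d e f : Kˣ) : groupG β d e f :=
  ⟨xElt β d e, (le_sup_right : subD β d e f ≤ groupG β d e f)
    (Subgroup.subset_closure (Set.mem_insert _ _))⟩

/-- The element `g` of `G`. -/
def gG (β : RingAut K) (d e f : Kˣ) : groupG β d e f :=
  ⟨gElt β, (le_sup_left : subF β ≤ groupG β d e f) ⟨gSp K, gSp_mem K, rfl⟩⟩

/-- The element `y = x ^ g = g⁻¹ x g` of `G`. -/
def yG (β : RingAut K) (d e f : Kˣ) : groupG β d e f :=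
  (gG β d e f)⁻¹ * xG β d e f * gG β d e f

/-- The conditions on the field elements: `d` and `e` have order `r ^ 2`, the set
`{d ^ r, d ^ (-r), e ^ r, e ^ (-r)}` has four elements, and `f` has order `t`. -/
structure IsAdmissible (r t : ℕ) (d e f : Kˣ) : Prop where
  order_d : orderOf d = r ^ 2
  order_e : orderOf e = r ^ 2
  four : ({d ^ r, (d ^ r)⁻¹, e ^ r, (e ^ r)⁻¹} : Set Kˣ).ncard = 4
  order_f : orderOf f = t

end Symplectic

instance factPrimeEleven : Fact (Nat.Prime 11) := ⟨by norm_num⟩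

end CommutingDiameter

open CommutingDiameter

/-! Write w = x ^ r. The graph argument is abstract and uses only the facts collected in
`IsConfiguration`: w centralizes c but x does not, w fixes no nontrivial element of F, and C_F(c) is
nontrivial but is moved by g so far that no nontrivial element of it commutes with a nontrivial
element of its conjugate.

Upper bound (`exists_commute_chain`): fix z ≠ 1 in the centre of F. Any h ≠ 1 commutes with a power
of prime order p, r or t. Order p puts this power in F. By Sylow, order t makes it conjugate into
⟨c⟩, and order r into ⟨w⟩, because the Sylow r-subgroup ⟨x⟩ is cyclic. The path w, c, C_F(c), z then
shows that h is within 4 of z, so any two vertices are within 8.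

Lower bound (`length_walk`): the first two steps of a path from x cannot leave D, so the third
vertex lies in D or in C_G(c) (`mem_D_or_commute_c`). From the end y = x ^ g the same holds up to
conjugation by g. On a path of length at most 7 these two vertices would commute, which
`not_commute_conj_of_cases` excludes: each has a nontrivial power in C_F(c), in ⟨c⟩ or in a
C_F(c)-conjugate of ⟨w⟩, and all nine combinations are impossible.

For the matrix group (`isConfiguration`), diag(u, v, v⁻¹, u⁻¹) scales the four coordinates of F by
the roots u/v, v², uv, u². Since q ≡ 1 mod r, the element w equals z ^ r, on which no root is
trivial. On c only u/v is trivial, so C_F(c) is one root subgroup; commuting with its conjugate by g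
comes down to 2ab = 0 in odd characteristic. -/

namespace CommutingDiameter

/-! ### Groups generated by two elements x, c with c x = x c ^ k, and Sylow preliminaries -/

section Pair

variable {Γ : Type*} [Group Γ]

theorem exists_pow_pow_eq_self {w : Γ} (hw : (orderOf w).Prime) {i : ℕ} (h : w ^ i ≠ 1) :
    ∃ m : ℕ, (w ^ i) ^ m = w :=
  exists_pow_eq_self_of_coprime
    ((hw.coprime_iff_not_dvd.2 fun hd => h (orderOf_dvd_iff_pow_eq_one.1 hd)).symm)

/-- Surjectivity of A × B → S bounds the order above; coprime divisors bound it below. Neither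
factor need be normal. -/
theorem card_eq_mul_of_coprime {S A B : Subgroup Γ} (hA : A ≤ S) (hB : B ≤ S) [Finite A] [Finite B]
    (hcop : (Nat.card A).Coprime (Nat.card B)) (h : ∀ s ∈ S, ∃ a ∈ A, ∃ b ∈ B, s = a * b) :
    Nat.card S = Nat.card A * Nat.card B := by
  let f : A × B → S := fun u => ⟨u.1 * u.2, S.mul_mem (hA u.1.2) (hB u.2.2)⟩
  have hf : Function.Surjective f := by
    rintro ⟨s, hs⟩
    obtain ⟨a, ha, b, hb, rfl⟩ := h s hs
    exact ⟨(⟨a, ha⟩, ⟨b, hb⟩), rfl⟩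
  have : Finite S := Finite.of_surjective f hf
  refine le_antisymm ?_ (Nat.le_of_dvd Nat.card_pos ?_)
  · rw [← Nat.card_prod]
    exact Nat.card_le_card_of_surjective f hf
  · exact hcop.mul_dvd_of_dvd_of_dvd (Subgroup.card_dvd_of_le hA) (Subgroup.card_dvd_of_le hB)

variable {x c : Γ} {k : ℕ}

theorem pow_mul_pow_of_mul_eq (h : c * x = x * c ^ k) (i j : ℕ) :
    c ^ i * x ^ j = x ^ j * c ^ (i * k ^ j) := by
  have h1 : ∀ i, c ^ i * x = x * c ^ (i * k) := by
    intro i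
    have : SemiconjBy x (c ^ k) c := h.symm
    rw [mul_comm i, pow_mul]
    exact (this.pow_right i).symm
  induction j generalizing i with
  | zero => simp
  | succ j ih =>
    rw [pow_succ, ← mul_assoc, ih, mul_assoc, h1, ← mul_assoc, pow_succ, mul_assoc i]

theorem exists_pow_mul_pow_pow (h : c * x = x * c ^ k) (j i n : ℕ) :
    ∃ m : ℕ, (x ^ j * c ^ i) ^ n = x ^ (j * n) * c ^ m := by
  induction n with
  | zero => exact ⟨0, by simp⟩
  | succ n ih =>
    obtain ⟨m, hm⟩ := ih
    refine ⟨m * k ^ j + i, ?_⟩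
    rw [pow_succ, hm, mul_assoc, ← mul_assoc (c ^ m), pow_mul_pow_of_mul_eq h, pow_add c, mul_assoc,
      ← mul_assoc, ← pow_add, mul_add_one]

/-- The power with exponent `orderOf x` already lies in ⟨c⟩. -/
theorem pow_mul_pow_pow_card (h : c * x = x * c ^ k) (j i : ℕ) :
    (x ^ j * c ^ i) ^ (orderOf x * orderOf c) = 1 := by
  obtain ⟨m, hm⟩ := exists_pow_mul_pow_pow h j i (orderOf x)
  rw [pow_mul, hm, mul_comm j, pow_mul, pow_orderOf_eq_one, one_pow, one_mul, ← pow_mul, mul_comm,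
    pow_mul, pow_orderOf_eq_one, one_pow]

theorem mem_closure_pair_iff_pow (h : c * x = x * c ^ k) (hx : 0 < orderOf x) (hc : 0 < orderOf c)
    {y : Γ} : y ∈ Subgroup.closure {x, c} ↔ ∃ j i : ℕ, y = x ^ j * c ^ i := by
  constructor
  · intro hy
    induction hy using Subgroup.closure_induction with
    | mem y hy =>
      rcases hy with rfl | rfl
      · exact ⟨1, 0, by simp⟩
      · exact ⟨0, 1, by simp⟩
    | one => exact ⟨0, 0, by simp⟩
    | mul y z _ _ hy hz =>
      obtain ⟨j, i, rfl⟩ := hy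
      obtain ⟨j', i', rfl⟩ := hz
      refine ⟨j + j', i * k ^ j' + i', ?_⟩
      rw [mul_assoc, ← mul_assoc (c ^ i), pow_mul_pow_of_mul_eq h, pow_add, pow_add]
      simp only [mul_assoc]
    | inv y _ hy =>
      obtain ⟨j, i, rfl⟩ := hy
      -- By `pow_mul_pow_pow_card` the inverse is the power with this exponent, so natural exponents
      -- suffice.
      obtain ⟨m, hm⟩ := exists_pow_mul_pow_pow h j i (orderOf x * orderOf c - 1)
      refine ⟨_, m, Eq.trans ?_ hm⟩
      refine inv_eq_of_mul_eq_one_right ?_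
      rw [← pow_succ', Nat.sub_add_cancel (Nat.mul_pos hx hc), pow_mul_pow_pow_card h]
  · rintro ⟨j, i, rfl⟩
    exact mul_mem (pow_mem (Subgroup.subset_closure (by simp)) _)
      (pow_mem (Subgroup.subset_closure (by simp)) _)

theorem card_closure_pair (h : c * x = x * c ^ k) (hx : 0 < orderOf x) (hc : 0 < orderOf c)
    (hcop : (orderOf x).Coprime (orderOf c)) :
    Nat.card (Subgroup.closure {x, c}) = orderOf x * orderOf c := by
  have : Finite (Subgroup.zpowers x) := Nat.finite_of_card_ne_zero (by simpa using hx.ne')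
  have : Finite (Subgroup.zpowers c) := Nat.finite_of_card_ne_zero (by simpa using hc.ne')
  rw [← Nat.card_zpowers x, ← Nat.card_zpowers c]
  refine card_eq_mul_of_coprime ?_ ?_ (by simpa using hcop) ?_
  · exact (Subgroup.zpowers_le).2 (Subgroup.subset_closure (by simp))
  · exact (Subgroup.zpowers_le).2 (Subgroup.subset_closure (by simp))
  · intro s hs
    obtain ⟨j, i, rfl⟩ := (mem_closure_pair_iff_pow h hx hc).1 hs
    exact ⟨_, pow_mem (Subgroup.mem_zpowers x) _, _, pow_mem (Subgroup.mem_zpowers c) _, rfl⟩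

theorem isMetacyclic_closure_pair (h : c * x = x * c ^ k) (hx : 0 < orderOf x)
    (hc : 0 < orderOf c) : IsMetacyclic (Subgroup.closure {x, c}) := by
  have hcm : c ∈ Subgroup.closure {x, c} := Subgroup.subset_closure (by simp)
  have hxm : x ∈ Subgroup.closure {x, c} := Subgroup.subset_closure (by simp)
  have hN : ((Subgroup.zpowers c).subgroupOf (Subgroup.closure {x, c})).Normal := by
    refine ⟨fun n hn d => ?_⟩
    obtain ⟨j, i, hd⟩ := (mem_closure_pair_iff_pow h hx hc).1 (d⁻¹).2
    rw [Subgroup.mem_subgroupOf] at hn ⊢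
    have hfin : IsOfFinOrder c := orderOf_pos_iff.1 hc
    obtain ⟨m, hm⟩ := hfin.mem_powers_iff_mem_zpowers.2 hn
    have hd' : (d : Γ) = (x ^ j * c ^ i)⁻¹ := by rw [← hd]; simp
    simp only [Subgroup.coe_mul, InvMemClass.coe_inv] at hd ⊢
    have hm : (n : Γ) = c ^ m := hm.symm
    rw [hd, hd', hm]
    have : (x ^ j * c ^ i)⁻¹ * c ^ m * (x ^ j * c ^ i) = (c ^ i)⁻¹ * c ^ (m * k ^ j) * c ^ i := by
      have h2 := pow_mul_pow_of_mul_eq h m j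
      calc (x ^ j * c ^ i)⁻¹ * c ^ m * (x ^ j * c ^ i)
          = (c ^ i)⁻¹ * ((x ^ j)⁻¹ * (c ^ m * x ^ j)) * c ^ i := by group
        _ = _ := by rw [h2]; group
    rw [this]
    have hcz := Subgroup.mem_zpowers c
    exact mul_mem (mul_mem (inv_mem (pow_mem hcz _)) (pow_mem hcz _)) (pow_mem hcz _)
  refine ⟨_, hN, ?_, ?_⟩
  · exact isCyclic_of_injective (Subgroup.subgroupOfEquivOfLe
      ((Subgroup.zpowers_le).2 hcm)).toMonoidHom (MulEquiv.injective _)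
  · refine ⟨QuotientGroup.mk ⟨x, hxm⟩, fun y => ?_⟩
    obtain ⟨⟨y, hy⟩, rfl⟩ := QuotientGroup.mk_surjective y
    obtain ⟨j, i, rfl⟩ := (mem_closure_pair_iff_pow h hx hc).1 hy
    refine ⟨j, ?_⟩
    simp only [zpow_natCast, ← QuotientGroup.mk_pow]
    rw [QuotientGroup.eq, Subgroup.mem_subgroupOf]
    simp [pow_mem (Subgroup.mem_zpowers c)]

/-- P is a Sylow subgroup, ⟨h⟩ lies in another one, and the two are conjugate. -/
theorem exists_conj_mem_of_orderOf_eq_prime [Finite Γ] {l : ℕ} (hl : l.Prime) {P : Subgroup Γ}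
    (hP : Nat.card P = l ^ (Nat.card Γ).factorization l) {h : Γ} (hh : orderOf h = l) :
    ∃ u : Γ, u * h * u⁻¹ ∈ P := by
  have : Fact l.Prime := ⟨hl⟩
  obtain ⟨Q, hQ⟩ := (IsPGroup.of_card (n := 1) (p := l) (G := Subgroup.zpowers h)
    (by simp [hh])).exists_le_sylow
  obtain ⟨u, hu⟩ := MulAction.exists_smul_eq Γ Q (Sylow.ofCard P hP)
  refine ⟨u, ?_⟩
  have h1 : (Sylow.ofCard P hP : Set Γ) = P := rfl
  rw [← SetLike.mem_coe, ← h1, ← hu, Sylow.coe_smul]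
  exact ⟨h, hQ (Subgroup.mem_zpowers h), rfl⟩

theorem exists_pow_orderOf_prime [Finite Γ] {h : Γ} (hh : h ≠ 1) :
    ∃ n : ℕ, (orderOf (h ^ n)).Prime := by
  have h1 : orderOf h ≠ 1 := fun h1 => hh (orderOf_eq_one_iff.1 h1)
  refine ⟨orderOf h / (orderOf h).minFac, ?_⟩
  rw [orderOf_pow_orderOf_div (orderOf_pos h).ne' (Nat.minFac_dvd _)]
  exact Nat.minFac_prime h1

end Pair

/-! ### Walks in the commuting graph -/

section Graph

variable {G : Type*} [Group G]

theorem edist_le_one_of_commute {a b : {g : G // g ∉ Subgroup.center G}}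
    (h : Commute (a : G) b) : (commutingGraph G).edist a b ≤ 1 := by
  rw [SimpleGraph.edist_le_one_iff_adj_or_eq]
  by_cases hab : a = b
  · exact Or.inr hab
  · exact Or.inl ⟨hab, h⟩

/-- A walk of length at most `n`, padded to exactly `n` steps. -/
theorem exists_commute_of_walk {n : ℕ} {a b : {g : G // g ∉ Subgroup.center G}}
    (p : (commutingGraph G).Walk a b) (hp : p.length ≤ n) :
    ∃ v : ℕ → {g : G // g ∉ Subgroup.center G}, v 0 = a ∧ v n = b ∧
      ∀ i, Commute (v i : G) (v (i + 1)) := by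
  refine ⟨p.getVert, p.getVert_zero, p.getVert_of_length_le hp, fun i => ?_⟩
  by_cases hi : i < p.length
  · exact (p.adj_getVert_succ hi).2
  · rw [p.getVert_of_length_le (not_lt.1 hi), p.getVert_of_length_le (by omega)]

end Graph

/-- The properties of `G = F ⋊ ⟨x, c⟩` and `g ∈ F` which determine the distances in the commuting
graph: `F` is a `p`-group, `x` and `c` have order `r ^ 2` and `t`, the element `x ^ r` centralizes
`c` and acts without fixed points on `F`, and no nontrivial element of `C_F(c)` commutes with a
nontrivial element of `C_F(c) ^ g`. -/
structure IsConfiguration {G : Type*} [Group G] (F : Subgroup G) (x c g : G) (p r t k : ℕ) :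
    Prop where
  prime_p : p.Prime
  prime_r : r.Prime
  prime_t : t.Prime
  p_ne_r : p ≠ r
  p_ne_t : p ≠ t
  r_ne_t : r ≠ t
  normal : F.Normal
  finite : Finite F
  isPGroup : IsPGroup p F
  order_x : orderOf x = r ^ 2
  order_c : orderOf c = t
  conj_c : c * x = x * c ^ k
  commute_c : Commute c (x ^ r)
  not_commute_c : ¬ Commute c x
  eq_one_of_commute : ∀ u ∈ F, Commute u (x ^ r) → u = 1
  g_mem : g ∈ F
  not_commute_g : ¬ Commute g c
  not_commute_conj : ∀ a ∈ F, ∀ b ∈ F, Commute a c → Commute b c → a ≠ 1 → b ≠ 1 →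
    ¬ Commute a (g⁻¹ * b * g)
  exists_commute_c : ∃ a ∈ F, a ≠ 1 ∧ Commute a c
  exists_central : ∃ z ∈ F, z ≠ 1 ∧ ∀ u ∈ F, Commute u z
  eq_mul : ∀ h : G, ∃ u ∈ F, ∃ d ∈ Subgroup.closure {x, c}, h = u * d

namespace IsConfiguration

variable {G : Type*} [Group G] {F : Subgroup G} {x c g : G} {p r t k : ℕ}

/-! ### Structure and centralizers of G = F D in the abstract configuration -/

section Basic

variable (H : IsConfiguration F x c g p r t k)

theorem x_mem : x ∈ Subgroup.closure {x, c} := Subgroup.subset_closure (by simp)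

theorem c_mem : c ∈ Subgroup.closure {x, c} := Subgroup.subset_closure (by simp)

include H

theorem orderOf_pow_r : orderOf (x ^ r) = r := by
  rw [orderOf_pow_of_dvd H.prime_r.ne_zero (by rw [H.order_x]; exact dvd_pow_self _ two_ne_zero),
    H.order_x, pow_two, Nat.mul_div_cancel _ H.prime_r.pos]

theorem order_x_pos : 0 < orderOf x := by rw [H.order_x]; exact pow_pos H.prime_r.pos 2

theorem order_c_pos : 0 < orderOf c := by rw [H.order_c]; exact H.prime_t.pos

theorem mem_closure_iff {y : G} : y ∈ Subgroup.closure {x, c} ↔ ∃ j i : ℕ, y = x ^ j * c ^ i :=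
  mem_closure_pair_iff_pow H.conj_c H.order_x_pos H.order_c_pos

theorem coprime_orders : (orderOf x).Coprime (orderOf c) := by
  rw [H.order_x, H.order_c]
  exact ((Nat.coprime_primes H.prime_r H.prime_t).2 H.r_ne_t).pow_left 2

theorem card_D : Nat.card (Subgroup.closure {x, c}) = r ^ 2 * t := by
  rw [card_closure_pair H.conj_c H.order_x_pos H.order_c_pos H.coprime_orders, H.order_x, H.order_c]

theorem finite_D : Finite (Subgroup.closure {x, c}) :=
  Nat.finite_of_card_ne_zero (by
    rw [H.card_D]; exact mul_ne_zero (pow_ne_zero 2 H.prime_r.ne_zero) H.prime_t.ne_zero)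

theorem exists_card_F : ∃ n, Nat.card F = p ^ n := by
  have := Fact.mk H.prime_p
  have := H.finite
  exact H.isPGroup.exists_card_eq

theorem coprime_p_card_D : p.Coprime (r ^ 2 * t) :=
  Nat.Coprime.mul_right (((Nat.coprime_primes H.prime_p H.prime_r).2 H.p_ne_r).pow_right 2)
    ((Nat.coprime_primes H.prime_p H.prime_t).2 H.p_ne_t)

theorem coprime_card : (Nat.card F).Coprime (Nat.card (Subgroup.closure {x, c})) := by
  obtain ⟨n, hn⟩ := H.exists_card_F
  rw [hn, H.card_D]
  exact H.coprime_p_card_D.pow_left n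

theorem disjoint : Disjoint F (Subgroup.closure {x, c}) := by
  exact Subgroup.disjoint_of_coprime_natCard H.coprime_card

theorem eq_one_of_mem_of_mem {y : G} (hF : y ∈ F) (hD : y ∈ Subgroup.closure {x, c}) : y = 1 :=
  Subgroup.disjoint_def.1 H.disjoint hF hD

theorem card_eq : Nat.card G = Nat.card F * (r ^ 2 * t) := by
  have := H.finite
  have := H.finite_D
  rw [← H.card_D, ← card_eq_mul_of_coprime (S := ⊤) le_top le_top H.coprime_card]
  · exact Subgroup.card_top.symm
  · intro s _
    exact H.eq_mul s

theorem finite_G : Finite G := Nat.finite_of_card_ne_zero (by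
  have := H.finite
  rw [H.card_eq]
  exact mul_ne_zero Nat.card_pos.ne'
    (mul_ne_zero (pow_ne_zero 2 H.prime_r.ne_zero) H.prime_t.ne_zero))

theorem isSolvable : Group.IsSolvable G := by
  have := Fact.mk H.prime_p
  have := H.finite
  have := H.normal
  have : Group.IsNilpotent F := H.isPGroup.isNilpotent
  obtain ⟨N, hN, h1, h2⟩ := isMetacyclic_closure_pair H.conj_c H.order_x_pos H.order_c_pos
  have hNs : Group.IsSolvable N := Group.isSolvable_of_comm h1.isMulCommutative.is_comm.comm
  have hQs : Group.IsSolvable (Subgroup.closure {x, c} ⧸ N) :=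
    Group.isSolvable_of_comm h2.isMulCommutative.is_comm.comm
  have hD : Group.IsSolvable (Subgroup.closure {x, c}) :=
    Group.isSolvable_of_ker_le_range N.subtype (QuotientGroup.mk' N) (by simp)
  have hq : Group.IsSolvable (G ⧸ F) := by
    refine Group.isSolvable_of_surjective
      (f := (QuotientGroup.mk' F).comp (Subgroup.closure {x, c}).subtype) fun y => ?_
    obtain ⟨y, rfl⟩ := QuotientGroup.mk_surjective y
    obtain ⟨u, hu, d, hd, rfl⟩ := H.eq_mul y
    refine ⟨⟨d, hd⟩, ?_⟩
    simp [hu]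
  exact Group.isSolvable_of_ker_le_range F.subtype (QuotientGroup.mk' F) (by simp)

/-- The commutator of e and d lies in D, and by the hypothesis it is also u⁻¹ (d u d⁻¹), an element
of F; hence it is trivial. -/
theorem commute_of_commute_mul {u d e : G} (hu : u ∈ F) (hd : d ∈ Subgroup.closure {x, c})
    (he : e ∈ Subgroup.closure {x, c}) (h : Commute (u * e) d) : Commute e d ∧ Commute u d := by
  have h1 : e * d * (d * e)⁻¹ = u⁻¹ * (d * u * d⁻¹) := by
    have : u * e * d = d * (u * e) := h
    calc e * d * (d * e)⁻¹ = u⁻¹ * (u * e * d) * (d * e)⁻¹ := by group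
      _ = _ := by rw [this]; group
  have h2 : e * d * (d * e)⁻¹ = 1 := H.eq_one_of_mem_of_mem
    (h1 ▸ mul_mem (inv_mem hu) (H.normal.conj_mem _ hu _))
    (mul_mem (mul_mem he hd) (inv_mem (mul_mem hd he)))
  refine ⟨mul_inv_eq_one.1 h2, ?_⟩
  rw [h2] at h1
  have h3 : u = d * u * d⁻¹ := (inv_mul_eq_one.1 h1.symm)
  exact eq_mul_inv_iff_mul_eq.1 h3

/-- The commutator d⁻¹ (u⁻¹ d u) lies in F ∩ D. -/
theorem commute_of_conj_mem {u d : G} (hu : u ∈ F) (hd : d ∈ Subgroup.closure {x, c})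
    (h : u⁻¹ * d * u ∈ Subgroup.closure {x, c}) : Commute u d := by
  have h1 : d⁻¹ * (u⁻¹ * d * u) = 1 := by
    refine H.eq_one_of_mem_of_mem ?_ (mul_mem (inv_mem hd) h)
    rw [show d⁻¹ * (u⁻¹ * d * u) = d⁻¹ * u⁻¹ * d⁻¹⁻¹ * u by group]
    exact mul_mem (H.normal.conj_mem _ (inv_mem hu) _) hu
  have h2 : d = u⁻¹ * d * u := inv_mul_eq_one.1 h1
  have : u * d = d * u := by
    nth_rw 1 [h2]
    group
  exact this

theorem commute_c_of_commute_pow {i : ℕ} {h : G} (hc : c ^ i ≠ 1) (hh : Commute h (c ^ i)) :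
    Commute h c := by
  obtain ⟨m, hm⟩ := exists_pow_pow_eq_self (by rw [H.order_c]; exact H.prime_t) hc
  rw [← hm]
  exact hh.pow_right m

theorem commute_w_of_commute_pow {i : ℕ} {h : G} (hc : (x ^ r) ^ i ≠ 1)
    (hh : Commute h ((x ^ r) ^ i)) : Commute h (x ^ r) := by
  obtain ⟨m, hm⟩ := exists_pow_pow_eq_self (by rw [H.orderOf_pow_r]; exact H.prime_r) hc
  rw [← hm]
  exact hh.pow_right m

theorem eq_one_of_commute_pow {i : ℕ} {u : G} (hu : u ∈ F) (hc : (x ^ r) ^ i ≠ 1)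
    (hh : Commute u ((x ^ r) ^ i)) : u = 1 :=
  H.eq_one_of_commute u hu (H.commute_w_of_commute_pow hc hh)

/-- The F-component of h is also centralized, hence trivial by the fixed-point-free action. -/
theorem mem_D_of_commute {i : ℕ} {h : G} (hc : (x ^ r) ^ i ≠ 1)
    (hh : Commute h ((x ^ r) ^ i)) : h ∈ Subgroup.closure {x, c} := by
  obtain ⟨u, hu, d, hd, rfl⟩ := H.eq_mul h
  have := (H.commute_of_commute_mul hu (pow_mem (pow_mem x_mem _) _) hd hh).2
  rwa [H.eq_one_of_commute_pow hu hc this, one_mul]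

/-- Otherwise x is a power of x ^ j and would centralize c. -/
theorem dvd_of_commute_c {j : ℕ} (h : Commute c (x ^ j)) : r ∣ j := by
  by_contra hj
  apply H.not_commute_c
  have hcop : j.Coprime (orderOf x) := by
    rw [H.order_x]
    exact (((H.prime_r.coprime_iff_not_dvd).2 hj).symm).pow_right 2
  obtain ⟨m, hm⟩ := exists_pow_eq_self_of_coprime hcop
  rw [← hm]
  exact h.pow_right m

theorem commute_c_pow_w (i j : ℕ) : Commute (c ^ i) ((x ^ r) ^ j) := H.commute_c.pow_pow i j

theorem pow_t_ne_one {j : ℕ} (h : (x ^ r) ^ j ≠ 1) : (x ^ r) ^ (j * t) ≠ 1 := by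
  intro h1
  apply h
  rw [← orderOf_dvd_iff_pow_eq_one, H.orderOf_pow_r] at h1 ⊢
  exact (((Nat.coprime_primes H.prime_r H.prime_t).2 H.r_ne_t).dvd_mul_right).1 h1

theorem mul_pow_t (i j : ℕ) : ((x ^ r) ^ j * c ^ i) ^ t = (x ^ r) ^ (j * t) := by
  rw [((H.commute_c_pow_w i j).symm).mul_pow, ← pow_mul c, mul_comm i, pow_mul c, ← H.order_c,
    pow_orderOf_eq_one, one_pow, mul_one, ← pow_mul]

/-- This dichotomy drives all centralizer arguments inside D. For d = x ^ j c ^ i, exponent t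
removes the c-part if r divides j; otherwise exponent r first moves the x-part into ⟨x ^ r⟩. -/
theorem eq_pow_or_exists_pow_eq {d : G} (hd : d ∈ Subgroup.closure {x, c}) :
    (∃ i, d = c ^ i) ∨ ∃ m i, d ^ m = (x ^ r) ^ i ∧ (x ^ r) ^ i ≠ 1 := by
  obtain ⟨j, i, rfl⟩ := H.mem_closure_iff.1 hd
  by_cases hj : r ∣ j
  · obtain ⟨j, rfl⟩ := hj
    rw [pow_mul x]
    by_cases h1 : (x ^ r) ^ j = 1
    · exact Or.inl ⟨i, by rw [h1, one_mul]⟩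
    · exact Or.inr ⟨t, _, H.mul_pow_t i j, H.pow_t_ne_one h1⟩
  · obtain ⟨m, hm⟩ := exists_pow_mul_pow_pow H.conj_c j i r
    refine Or.inr ⟨r * t, j * t, ?_, H.pow_t_ne_one ?_⟩
    · rw [pow_mul, hm, mul_comm j, pow_mul x, H.mul_pow_t]
    · rwa [ne_eq, ← orderOf_dvd_iff_pow_eq_one, H.orderOf_pow_r]

theorem center_eq_bot : Subgroup.center G = ⊥ := by
  rw [eq_bot_iff]
  intro h hh
  have hcomm : ∀ y, Commute h y := fun y => ((Subgroup.mem_center_iff.1 hh) y).symm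
  obtain ⟨u, hu, d, hd, rfl⟩ := H.eq_mul h
  have hu1 : u = 1 := H.eq_one_of_commute u hu
    (H.commute_of_commute_mul hu (pow_mem x_mem r) hd (hcomm _)).2
  subst hu1
  simp only [one_mul] at hcomm ⊢
  obtain ⟨z, hz, hz1, -⟩ := H.exists_central
  rcases H.eq_pow_or_exists_pow_eq hd with ⟨i, rfl⟩ | ⟨m, i, h1, h2⟩
  · by_contra hne
    exact H.not_commute_c (H.commute_c_of_commute_pow hne (hcomm x).symm).symm
  · exact absurd (H.eq_one_of_commute_pow hz h2 (h1 ▸ ((hcomm z).pow_left m).symm)) hz1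

theorem not_mem_center {h : G} : h ∉ Subgroup.center G ↔ h ≠ 1 := by
  rw [H.center_eq_bot, Subgroup.mem_bot]

/-- The D-component has order dividing both p and r ^ 2 * t. -/
theorem pow_p_mem {h : G} (hh : h ^ p = 1) : h ∈ F := by
  have := H.normal
  obtain ⟨u, hu, d, hd, rfl⟩ := H.eq_mul h
  have hu1 : (QuotientGroup.mk u : G ⧸ F) = 1 := (QuotientGroup.eq_one_iff u).2 hu
  have h1 : (QuotientGroup.mk (d ^ p) : G ⧸ F) = 1 := by
    have := congrArg (QuotientGroup.mk : G → G ⧸ F) hh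
    rwa [QuotientGroup.mk_pow, QuotientGroup.mk_mul, hu1, one_mul, ← QuotientGroup.mk_pow,
      QuotientGroup.mk_one] at this
  have h2 : d ^ p = 1 := H.eq_one_of_mem_of_mem ((QuotientGroup.eq_one_iff _).1 h1) (pow_mem hd _)
  have h3 : d ^ (r ^ 2 * t) = 1 := by
    have := pow_card_eq_one' (x := (⟨d, hd⟩ : Subgroup.closure {x, c}))
    rw [H.card_D] at this
    exact congrArg Subtype.val this
  have h4 : d = 1 := by
    rw [← orderOf_eq_one_iff]
    exact Nat.eq_one_of_dvd_coprimes H.coprime_p_card_D (orderOf_dvd_of_pow_eq_one h2)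
      (orderOf_dvd_of_pow_eq_one h3)
  rw [h4, mul_one]
  exact hu

end Basic

/-! ### Upper and lower bounds for distances in the commuting graph -/

section Distance

variable (H : IsConfiguration F x c g p r t k)
include H

theorem exists_conj_mem_zpowers_c {h : G} (hh : orderOf h = t) :
    ∃ u : G, u * h * u⁻¹ ∈ Subgroup.zpowers c := by
  have := H.finite_G
  refine exists_conj_mem_of_orderOf_eq_prime H.prime_t ?_ hh
  obtain ⟨n, hn⟩ := H.exists_card_F
  have h1 : (Nat.card G).factorization t = 1 := by
    rw [H.card_eq, hn, ← mul_assoc, Nat.factorization_mul (mul_ne_zero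
      (pow_ne_zero _ H.prime_p.ne_zero) (pow_ne_zero _ H.prime_r.ne_zero)) H.prime_t.ne_zero,
      Nat.factorization_mul (pow_ne_zero _ H.prime_p.ne_zero) (pow_ne_zero _ H.prime_r.ne_zero),
      H.prime_p.factorization_pow, H.prime_r.factorization_pow, H.prime_t.factorization]
    simp [H.p_ne_t, H.r_ne_t]
  rw [h1, Nat.card_zpowers, H.order_c, pow_one]

theorem exists_conj_mem_zpowers_x {h : G} (hh : orderOf h = r) :
    ∃ u : G, u * h * u⁻¹ ∈ Subgroup.zpowers x := by
  have := H.finite_G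
  refine exists_conj_mem_of_orderOf_eq_prime H.prime_r ?_ hh
  obtain ⟨n, hn⟩ := H.exists_card_F
  have h1 : (Nat.card G).factorization r = 2 := by
    rw [H.card_eq, hn, ← mul_assoc, Nat.factorization_mul (mul_ne_zero
      (pow_ne_zero _ H.prime_p.ne_zero) (pow_ne_zero _ H.prime_r.ne_zero)) H.prime_t.ne_zero,
      Nat.factorization_mul (pow_ne_zero _ H.prime_p.ne_zero) (pow_ne_zero _ H.prime_r.ne_zero),
      H.prime_p.factorization_pow, H.prime_r.factorization_pow, H.prime_t.factorization]
    simp [H.p_ne_r, H.r_ne_t.symm]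
  rw [h1, Nat.card_zpowers, H.order_x]

/-- Every nontrivial element has distance at most `4` from the centre of `F`. -/
theorem exists_commute_chain {z : G} (hz1 : z ≠ 1) (hz : ∀ u ∈ F, Commute u z)
    {h : G} (hh : h ≠ 1) : ∃ h₁ h₂ h₃ : G, h₁ ≠ 1 ∧ h₂ ≠ 1 ∧ h₃ ≠ 1 ∧
      Commute h h₁ ∧ Commute h₁ h₂ ∧ Commute h₂ h₃ ∧ Commute h₃ z := by
  have := H.finite_G
  have hcne : c ≠ 1 := by
    rw [ne_eq, ← orderOf_eq_one_iff, H.order_c]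
    exact H.prime_t.one_lt.ne'
  obtain ⟨a, haF, ha1, hac⟩ := H.exists_commute_c
  have conj_ne : ∀ {u y : G}, y ≠ 1 → u⁻¹ * y * u ≠ 1 := by
    intro u y hy h1
    apply hy
    have h2 : y = u * (u⁻¹ * y * u) * u⁻¹ := by group
    rw [h2, h1, mul_one, mul_inv_cancel]
  have conj_comm : ∀ {u y y' : G}, Commute y y' → Commute (u⁻¹ * y * u) (u⁻¹ * y' * u) := by
    intro u y y' hy
    have := hy.map (MulAut.conj u⁻¹).toMonoidHom
    simpa [MulAut.conj_apply] using this
  have conj_F : ∀ u : G, u⁻¹ * a * u ∈ F := by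
    intro u
    have := H.normal.conj_mem a haF u⁻¹
    rwa [inv_inv] at this
  obtain ⟨n, hn⟩ := exists_pow_orderOf_prime hh
  have hne : h ^ n ≠ 1 := fun h1 => hn.ne_one (orderOf_eq_one_iff.2 h1)
  have hcomm : Commute h (h ^ n) := (Commute.refl h).pow_right n
  have hdvd : orderOf (h ^ n) ∣ Nat.card G := orderOf_dvd_natCard _
  obtain ⟨m, hm⟩ := H.exists_card_F
  rw [H.card_eq, hm, hn.dvd_mul, hn.dvd_mul] at hdvd
  rcases hdvd with hd | hd | hd
  · have hp := (Nat.prime_dvd_prime_iff_eq hn H.prime_p).1 (hn.dvd_of_dvd_pow hd)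
    have hF : h ^ n ∈ F := H.pow_p_mem (hp ▸ pow_orderOf_eq_one _)
    -- The chain may repeat vertices, so shorter paths are padded.
    exact ⟨h ^ n, z, z, hne, hz1, hz1, hcomm, hz _ hF, Commute.refl _, Commute.refl _⟩
  · have hr := (Nat.prime_dvd_prime_iff_eq hn H.prime_r).1 (hn.dvd_of_dvd_pow hd)
    obtain ⟨u, hu⟩ := H.exists_conj_mem_zpowers_x hr
    obtain ⟨j, hj⟩ := (isOfFinOrder_of_finite x).mem_powers_iff_mem_zpowers.2 hu
    have hj : x ^ j = u * h ^ n * u⁻¹ := hj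
    have hj' : h ^ n = u⁻¹ * x ^ j * u := by rw [hj]; group
    -- An element of order r in the cyclic group ⟨x⟩ of order r ^ 2 lies in ⟨x ^ r⟩.
    have hrj : r ∣ j := by
      have h1 : x ^ (j * r) = 1 := by
        rw [pow_mul, hj, conj_pow, ← hr, pow_orderOf_eq_one]
        group
      rw [← orderOf_dvd_iff_pow_eq_one, H.order_x, pow_two] at h1
      exact Nat.dvd_of_mul_dvd_mul_right H.prime_r.pos h1
    obtain ⟨j, rfl⟩ := hrj
    refine ⟨h ^ n, u⁻¹ * c * u, u⁻¹ * a * u, hne, conj_ne hcne, conj_ne ha1, hcomm, ?_,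
      conj_comm hac.symm, hz _ (conj_F u)⟩
    rw [hj', pow_mul]
    exact conj_comm (H.commute_c.pow_right j).symm
  · have ht := (Nat.prime_dvd_prime_iff_eq hn H.prime_t).1 hd
    obtain ⟨u, hu⟩ := H.exists_conj_mem_zpowers_c ht
    obtain ⟨j, hj⟩ := (isOfFinOrder_of_finite c).mem_powers_iff_mem_zpowers.2 hu
    have hj : c ^ j = u * h ^ n * u⁻¹ := hj
    have hj' : h ^ n = u⁻¹ * c ^ j * u := by rw [hj]; group
    refine ⟨h ^ n, u⁻¹ * a * u, u⁻¹ * a * u, hne, conj_ne ha1, conj_ne ha1, hcomm, ?_,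
      Commute.refl _, hz _ (conj_F u)⟩
    rw [hj']
    exact conj_comm (hac.symm.pow_left j)

theorem edist_le (a b : {h : G // h ∉ Subgroup.center G}) : (commutingGraph G).edist a b ≤ 8 := by
  obtain ⟨z, hzF, hz1, hz⟩ := H.exists_central
  have key : ∀ a : {h : G // h ∉ Subgroup.center G},
      (commutingGraph G).edist a ⟨z, H.not_mem_center.2 hz1⟩ ≤ 4 := by
    intro a
    obtain ⟨h₁, h₂, h₃, n₁, n₂, n₃, c₁, c₂, c₃, c₄⟩ :=
      H.exists_commute_chain hz1 hz (H.not_mem_center.1 a.2)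
    have e₁ := edist_le_one_of_commute (a := a) (b := ⟨h₁, H.not_mem_center.2 n₁⟩) c₁
    have e₂ := edist_le_one_of_commute (a := ⟨h₁, H.not_mem_center.2 n₁⟩)
      (b := ⟨h₂, H.not_mem_center.2 n₂⟩) c₂
    have e₃ := edist_le_one_of_commute (a := ⟨h₂, H.not_mem_center.2 n₂⟩)
      (b := ⟨h₃, H.not_mem_center.2 n₃⟩) c₃
    have e₄ := edist_le_one_of_commute (a := ⟨h₃, H.not_mem_center.2 n₃⟩)
      (b := ⟨z, H.not_mem_center.2 hz1⟩) c₄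
    calc _ ≤ _ := SimpleGraph.edist_triangle.trans (add_le_add (SimpleGraph.edist_triangle.trans
            (add_le_add (SimpleGraph.edist_triangle.trans (add_le_add e₁ e₂)) e₃)) e₄)
      _ = 4 := by norm_num
  calc _ ≤ _ := SimpleGraph.edist_triangle.trans
        (add_le_add (key a) (SimpleGraph.edist_comm.trans_le (key b)))
    _ = 8 := by norm_num

/-- v₁ centralizes x ^ r, so lies in D; it is no power of c, since x does not centralize c. Hence it
has a nontrivial power in ⟨x ^ r⟩, which forces v₂ into D. Only if v₂ is a power of c can v₃ escape
from D, and then v₃ centralizes c. -/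
theorem mem_D_or_commute_c {v₁ v₂ v₃ : G} (n₁ : v₁ ≠ 1) (n₂ : v₂ ≠ 1) (h₁ : Commute x v₁)
    (h₂ : Commute v₁ v₂) (h₃ : Commute v₂ v₃) :
    v₃ ∈ Subgroup.closure {x, c} ∨ Commute v₃ c := by
  have hw1 : (x ^ r) ^ 1 ≠ 1 := by
    rw [pow_one, ne_eq, ← orderOf_eq_one_iff, H.orderOf_pow_r]
    exact H.prime_r.one_lt.ne'
  have m₁ : v₁ ∈ Subgroup.closure {x, c} :=
    H.mem_D_of_commute hw1 (by rw [pow_one]; exact (h₁.pow_left r).symm)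
  have m₂ : v₂ ∈ Subgroup.closure {x, c} := by
    rcases H.eq_pow_or_exists_pow_eq m₁ with ⟨i, rfl⟩ | ⟨m, i, e, ne⟩
    · exact absurd (H.commute_c_of_commute_pow n₁ h₁).symm H.not_commute_c
    · exact H.mem_D_of_commute ne (e ▸ (h₂.pow_left m).symm)
  rcases H.eq_pow_or_exists_pow_eq m₂ with ⟨i, rfl⟩ | ⟨m, i, e, ne⟩
  · exact Or.inr (H.commute_c_of_commute_pow n₂ h₃.symm)
  · exact Or.inl (H.mem_D_of_commute ne (e ▸ (h₃.pow_left m).symm))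

/-- With w now the given power of x ^ r, the map a ↦ a⁻¹ (w a w⁻¹) on C_F(c) is injective because w
has no fixed points there, hence surjective by finiteness. A preimage of u is the required a. -/
theorem exists_conj_eq_mul {u : G} (hu : u ∈ F) (huc : Commute u c) {j : ℕ}
    (hj : (x ^ r) ^ j ≠ 1) :
    ∃ a ∈ F, Commute a c ∧ u * (x ^ r) ^ j = a⁻¹ * (x ^ r) ^ j * a := by
  have := H.finite_G
  set w := (x ^ r) ^ j with hw
  have hwc : Commute w c := (H.commute_c.pow_right j).symm
  let A : Subgroup G := F ⊓ Subgroup.centralizer {c}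
  have hA : ∀ a, a ∈ A ↔ a ∈ F ∧ Commute a c := fun a => by
    rw [Subgroup.mem_inf, Subgroup.mem_centralizer_singleton_iff]
    exact Iff.rfl
  have hmem : ∀ a : A, (a : G)⁻¹ * (w * a * w⁻¹) ∈ A := by
    intro a
    refine mul_mem (inv_mem a.2) ((hA _).2 ⟨H.normal.conj_mem _ ((hA _).1 a.2).1 _, ?_⟩)
    exact (hwc.mul_left ((hA _).1 a.2).2).mul_left hwc.inv_left
  have hinj : Function.Injective fun a : A => (⟨_, hmem a⟩ : A) := by
    intro a b hab
    have h1 : (a : G)⁻¹ * (w * a * w⁻¹) = (b : G)⁻¹ * (w * b * w⁻¹) := congrArg Subtype.val hab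
    have h2 : (b : G) * (a : G)⁻¹ * w = w * (b * (a : G)⁻¹) := by
      calc (b : G) * (a : G)⁻¹ * w = b * ((a : G)⁻¹ * (w * a * w⁻¹)) * w * (a : G)⁻¹ := by group
        _ = _ := by rw [h1]; group
    have h3 := H.eq_one_of_commute_pow (mul_mem ((hA _).1 b.2).1 (inv_mem ((hA _).1 a.2).1)) hj h2
    exact Subtype.ext (mul_inv_eq_one.1 h3).symm
  obtain ⟨a, ha⟩ := Finite.surjective_of_injective hinj ⟨u, (hA _).2 ⟨hu, huc⟩⟩
  have h1 : (a : G)⁻¹ * (w * a * w⁻¹) = u := congrArg Subtype.val ha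
  refine ⟨a, ((hA _).1 a.2).1, ((hA _).1 a.2).2, ?_⟩
  rw [← h1]
  group

theorem pow_t_ne_one_of_mem {u : G} (hu : u ∈ F) (h1 : u ≠ 1) : u ^ t ≠ 1 := by
  intro h
  apply h1
  obtain ⟨n, hn⟩ := H.exists_card_F
  have h2 : u ^ (p ^ n) = 1 := by
    have := pow_card_eq_one' (x := (⟨u, hu⟩ : F))
    rw [hn] at this
    exact congrArg Subtype.val this
  rw [← orderOf_eq_one_iff]
  exact Nat.eq_one_of_dvd_coprimes (((Nat.coprime_primes H.prime_p H.prime_t).2 H.p_ne_t).pow_left n)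
    (orderOf_dvd_of_pow_eq_one h2) (orderOf_dvd_of_pow_eq_one h)

/-- A nontrivial element of `D` or of `C_G(c)` has a nontrivial power in `C_F(c)`, in `⟨c⟩`, or in
a conjugate of `⟨x ^ r⟩` under `C_F(c)`. -/
theorem exists_pow_cases {h : G} (hh : h ∈ Subgroup.closure {x, c} ∨ Commute h c) (h1 : h ≠ 1) :
    ∃ n : ℕ, h ^ n ≠ 1 ∧ ((h ^ n ∈ F ∧ Commute (h ^ n) c) ∨ (∃ i : ℕ, h ^ n = c ^ i) ∨
      ∃ a ∈ F, Commute a c ∧ ∃ i : ℕ, (x ^ r) ^ i ≠ 1 ∧ h ^ n = a⁻¹ * (x ^ r) ^ i * a) := by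
  rcases hh with hD | hc
  · rcases H.eq_pow_or_exists_pow_eq hD with ⟨i, hi⟩ | ⟨m, i, e, ne⟩
    · exact ⟨1, by rwa [pow_one], Or.inr (Or.inl ⟨i, by rwa [pow_one]⟩)⟩
    · exact ⟨m, e ▸ ne, Or.inr (Or.inr ⟨1, one_mem _, Commute.one_left _, i, ne, by simp [e]⟩)⟩
  · obtain ⟨u, hu, d, hd, rfl⟩ := H.eq_mul h
    obtain ⟨hdc, huc⟩ := H.commute_of_commute_mul hu c_mem hd hc
    obtain ⟨j, i, rfl⟩ := H.mem_closure_iff.1 hd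
    have hxj : Commute (x ^ j) c := by
      have := hdc.mul_left ((Commute.refl c).pow_left i).inv_left
      rwa [mul_inv_cancel_right] at this
    -- Now h = u w ^ j c ^ i with w = x ^ r, and c commutes with each factor; exponent t removes c ^
    -- i.
    obtain ⟨j, rfl⟩ := H.dvd_of_commute_c hxj.symm
    rw [pow_mul] at *
    by_cases hj : (x ^ r) ^ j = 1
    · rw [hj, one_mul] at h1 ⊢
      by_cases hu1 : u = 1
      · exact ⟨1, by rwa [pow_one], Or.inr (Or.inl ⟨i, by rw [hu1, pow_one, one_mul]⟩)⟩
      · have h2 : (u * c ^ i) ^ t = u ^ t := by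
          rw [(huc.pow_right i).mul_pow, ← pow_mul c, mul_comm i, pow_mul c, ← H.order_c,
            pow_orderOf_eq_one, one_pow, mul_one]
        refine ⟨t, ?_, Or.inl ?_⟩ <;> rw [h2]
        · exact H.pow_t_ne_one_of_mem hu hu1
        · exact ⟨pow_mem hu t, huc.pow_left t⟩
    · obtain ⟨a, ha, hac, e⟩ := H.exists_conj_eq_mul hu huc hj
      have h2 : (u * ((x ^ r) ^ j * c ^ i)) ^ t = a⁻¹ * (x ^ r) ^ (j * t) * a := by
        have h3 : Commute (u * (x ^ r) ^ j) (c ^ i) := (huc.mul_left hxj).pow_right i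
        rw [← mul_assoc, h3.mul_pow, ← pow_mul c, mul_comm i, pow_mul c, ← H.order_c,
          pow_orderOf_eq_one, one_pow, mul_one, e, pow_mul _ j]
        have := conj_pow (i := orderOf c) (a := a⁻¹) (b := (x ^ r) ^ j)
        rwa [inv_inv] at this
      have h4 := H.pow_t_ne_one hj
      refine ⟨t, ?_, Or.inr (Or.inr ⟨a, ha, hac, _, h4, h2⟩)⟩
      rw [h2]
      intro h5
      apply h4
      have : (x ^ r) ^ (j * t) = a * (a⁻¹ * (x ^ r) ^ (j * t) * a) * a⁻¹ := by group
      rw [this, h5, mul_one, mul_inv_cancel]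

omit H in
theorem commute_conj_iff {u y z : G} : Commute (u⁻¹ * y * u) z ↔ Commute y (u * z * u⁻¹) := by
  constructor
  · intro h
    have := h.map (MulAut.conj u).toMonoidHom
    simpa [MulAut.conj_apply, mul_assoc] using this
  · intro h
    have := h.map (MulAut.conj u⁻¹).toMonoidHom
    simpa [MulAut.conj_apply, mul_assoc] using this

/-- After replacing h and k by the powers from `exists_pow_cases`, every case makes g centralize c,
gives commuting elements of C_F(c) and its conjugate, or gives a fixed point of x ^ r in F. -/
theorem not_commute_conj_of_cases {h k : G} (hh : h ∈ Subgroup.closure {x, c} ∨ Commute h c)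
    (hk : k ∈ Subgroup.closure {x, c} ∨ Commute k c) (h1 : h ≠ 1) (k1 : k ≠ 1) :
    ¬ Commute h (g⁻¹ * k * g) := by
  intro hcomm
  have hwmem : ∀ i : ℕ, (x ^ r) ^ i ∈ Subgroup.closure {x, c} :=
    fun i => pow_mem (pow_mem x_mem _) _
  have hcmem : ∀ i : ℕ, c ^ i ∈ Subgroup.closure {x, c} := fun i => pow_mem c_mem _
  obtain ⟨n, hn1, hn⟩ := H.exists_pow_cases hh h1
  obtain ⟨m, hm1, hm⟩ := H.exists_pow_cases hk k1
  have conj_F : ∀ {u y : G}, y ∈ F → u⁻¹ * y * u ∈ F := by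
    intro u y hy
    have := H.normal.conj_mem y hy u⁻¹
    rwa [inv_inv] at this
  have hcomm : Commute (h ^ n) (g⁻¹ * k ^ m * g) := by
    have := hcomm.pow_pow n m
    have e : (g⁻¹ * k * g) ^ m = g⁻¹ * k ^ m * g := by
      have := conj_pow (i := m) (a := g⁻¹) (b := k)
      rwa [inv_inv] at this
    rwa [e] at this
  generalize h ^ n = h at *
  generalize k ^ m = k at *
  have no_fix : ∀ {u v : G} {i : ℕ}, u ∈ F → u ≠ 1 → (x ^ r) ^ i ≠ 1 →
      ¬ Commute u (v⁻¹ * (x ^ r) ^ i * v) := by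
    intro u v i hu hu1 hi hc
    have h2 := commute_conj_iff.1 hc.symm
    have h3 := H.eq_one_of_commute_pow (H.normal.conj_mem u hu v) hi h2.symm
    apply hu1
    rw [show u = v⁻¹ * (v * u * v⁻¹) * v by group, h3, mul_one, inv_mul_cancel]
  have conj_ne : g⁻¹ * k * g ≠ 1 := by
    intro h2
    apply hm1
    rw [show k = g * (g⁻¹ * k * g) * g⁻¹ by group, h2, mul_one, mul_inv_cancel]
  rcases hm with ⟨hkF, hkc⟩ | ⟨i, rfl⟩ | ⟨b, hbF, hbc, i, hi, rfl⟩
  · rcases hn with ⟨hhF, hhc⟩ | ⟨j, rfl⟩ | ⟨a, haF, hac, j, hj, rfl⟩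
    · exact H.not_commute_conj h hhF k hkF hhc hkc hn1 hm1 hcomm
    · have h2 := H.commute_c_of_commute_pow hn1 hcomm.symm
      -- The conjugate of k by g lies in C_F(c) itself and commutes with itself.
      exact H.not_commute_conj _ (conj_F hkF) k hkF h2 hkc conj_ne hm1 (Commute.refl _)
    · exact no_fix (conj_F hkF) conj_ne hj hcomm.symm
  · rcases hn with ⟨hhF, hhc⟩ | ⟨j, rfl⟩ | ⟨a, haF, hac, j, hj, rfl⟩
    · have h2 := H.commute_c_of_commute_pow hm1 (commute_conj_iff.1 hcomm.symm).symm
      refine H.not_commute_conj h hhF (g * h * g⁻¹) (H.normal.conj_mem _ hhF _) hhc h2 hn1 ?_ ?_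
      · intro h3
        apply hn1
        rw [show h = g⁻¹ * (g * h * g⁻¹) * g by group, h3, mul_one, inv_mul_cancel]
      · rw [show g⁻¹ * (g * h * g⁻¹) * g = h by group]
    · have h2 : Commute (g⁻¹ * c ^ i * g) c := H.commute_c_of_commute_pow hn1 hcomm.symm
      have h3 : g⁻¹ * c ^ i * g = (g⁻¹ * (c ^ i * g * (c ^ i)⁻¹)) * c ^ i := by group
      have h4 : g⁻¹ * (c ^ i * g * (c ^ i)⁻¹) ∈ F :=
        mul_mem (inv_mem H.g_mem) (H.normal.conj_mem _ H.g_mem _)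
      have h5 := (H.commute_of_commute_mul h4 c_mem (hcmem i) (h3 ▸ h2)).2
      -- This is the F-part of g⁻¹ c ^ i g. It commutes with c, so its t-th power is trivial, and F
      -- is a p-group with p ≠ t.
      have h6 : g⁻¹ * (c ^ i * g * (c ^ i)⁻¹) = 1 := by
        by_contra hne
        apply H.pow_t_ne_one_of_mem h4 hne
        have h7 : (g⁻¹ * c ^ i * g) ^ t = 1 := by
          have := conj_pow (i := t) (a := g⁻¹) (b := c ^ i)
          rw [inv_inv] at this
          rw [this, ← pow_mul, mul_comm, pow_mul, ← H.order_c, pow_orderOf_eq_one, one_pow,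
            mul_one, inv_mul_cancel]
        rwa [h3, (h5.pow_right i).mul_pow, ← pow_mul c, mul_comm i, pow_mul c, ← H.order_c,
          pow_orderOf_eq_one, one_pow, mul_one, H.order_c] at h7
      have h8 : Commute g (c ^ i) :=
        (eq_mul_inv_iff_mul_eq.1 (inv_mul_eq_one.1 h6))
      exact H.not_commute_g (H.commute_c_of_commute_pow hm1 h8)
    · -- conjugating by `a`, the element `(c ^ i) ^ (g * a⁻¹)` centralizes a power of `x ^ r`
      have h2 := H.mem_D_of_commute hj (commute_conj_iff.1 hcomm).symm
      rw [show a * (g⁻¹ * c ^ i * g) * a⁻¹ = (g * a⁻¹)⁻¹ * c ^ i * (g * a⁻¹) by group] at h2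
      have h3 := H.commute_of_conj_mem (mul_mem H.g_mem (inv_mem haF)) (hcmem i) h2
      have h4 := (H.commute_c_of_commute_pow hm1 h3).mul_left hac
      rw [inv_mul_cancel_right] at h4
      exact H.not_commute_g h4
  · rw [show g⁻¹ * (b⁻¹ * (x ^ r) ^ i * b) * g = (b * g)⁻¹ * (x ^ r) ^ i * (b * g) by group]
      at hcomm
    rcases hn with ⟨hhF, hhc⟩ | ⟨j, rfl⟩ | ⟨a, haF, hac, j, hj, rfl⟩
    · exact no_fix hhF hn1 hi hcomm
    · have h2 := H.mem_D_of_commute hi (commute_conj_iff.1 hcomm.symm).symm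
      have h3 := H.commute_of_conj_mem (u := (b * g)⁻¹) (inv_mem (mul_mem hbF H.g_mem)) (hcmem j)
        (by rwa [inv_inv])
      have h4 := hbc.inv_left.mul_left (H.commute_c_of_commute_pow hn1 h3).inv_left
      rw [inv_inv, inv_mul_cancel_left] at h4
      exact H.not_commute_g h4
    · have h2 := H.mem_D_of_commute hj (commute_conj_iff.1 hcomm).symm
      rw [show a * ((b * g)⁻¹ * (x ^ r) ^ i * (b * g)) * a⁻¹ =
        (b * g * a⁻¹)⁻¹ * (x ^ r) ^ i * (b * g * a⁻¹) by group] at h2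
      have h3 := mul_mem (mul_mem hbF H.g_mem) (inv_mem haF)
      -- So b g a⁻¹ = 1 and g = b⁻¹ a would centralize c.
      have h4 := H.eq_one_of_commute_pow h3 hi (H.commute_of_conj_mem h3 (hwmem i) h2)
      have h5 : Commute (b⁻¹ * a) c := hbc.inv_left.mul_left hac
      rw [show b⁻¹ * a = g by rw [← mul_inv_eq_one.1 h4]; group] at h5
      exact H.not_commute_g h5

theorem length_walk {a b : {h : G // h ∉ Subgroup.center G}} (ha : (a : G) = x)
    (hb : (b : G) = g⁻¹ * x * g) (p : (commutingGraph G).Walk a b) : 8 ≤ p.length := by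
  by_contra hlt
  -- With exactly seven steps, v 3 is three steps from x, v 4 is three steps from y, and the two
  -- commute. Conjugating by g turns y into x for the second half.
  obtain ⟨v, v0, v7, hv⟩ := exists_commute_of_walk p (n := 7) (by omega)
  have ne : ∀ i, (v i : G) ≠ 1 := fun i => H.not_mem_center.1 (v i).2
  have ne' : ∀ i, g * (v i : G) * g⁻¹ ≠ 1 := fun i h => ne i (by
    rw [show (v i : G) = g⁻¹ * (g * v i * g⁻¹) * g by group, h, mul_one, inv_mul_cancel])
  have hv' : ∀ i, Commute (g * (v (i + 1) : G) * g⁻¹) (g * v i * g⁻¹) := fun i => by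
    have := (hv i).symm.map (MulAut.conj g).toMonoidHom
    simpa [MulAut.conj_apply] using this
  have hx' : Commute x (g * (v 6 : G) * g⁻¹) := by
    have := hv' 6
    rwa [v7, hb, show g * (g⁻¹ * x * g) * g⁻¹ = x by group] at this
  have h3 := H.mem_D_or_commute_c (ne 1) (ne 2) (by simpa [v0, ha] using hv 0) (hv 1) (hv 2)
  have h4 := H.mem_D_or_commute_c (ne' 6) (ne' 5) hx' (hv' 5) (hv' 4)
  refine H.not_commute_conj_of_cases h3 h4 (ne 3) (ne' 4) ?_
  rw [show g⁻¹ * (g * (v 4 : G) * g⁻¹) * g = v 4 by group]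
  exact hv 3

theorem x_not_mem_center : x ∉ Subgroup.center G := fun h =>
  H.not_commute_c (Subgroup.mem_center_iff.1 h c)

theorem connected : (commutingGraph G).Connected := by
  have : Nonempty {h : G // h ∉ Subgroup.center G} := ⟨⟨x, H.x_not_mem_center⟩⟩
  exact SimpleGraph.connected_of_ediam_ne_top
    (((SimpleGraph.ediam_le_of_edist_le H.edist_le).trans_lt (ENat.natCast_lt_top 8)).ne)

theorem dist_eq {a b : {h : G // h ∉ Subgroup.center G}} (ha : (a : G) = x)
    (hb : (b : G) = g⁻¹ * x * g) : (commutingGraph G).dist a b = 8 := by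
  refine le_antisymm ?_ ?_
  · have h1 := H.edist_le a b
    rw [← (H.connected a b).coe_dist_eq_edist] at h1
    exact_mod_cast h1
  · obtain ⟨p, hp⟩ := H.connected.exists_walk_length_eq_dist a b
    rw [← hp]
    exact H.length_walk ha hb p

theorem exists_dist_eq {y : G} (hy : y = g⁻¹ * x * g) :
    ∃ (hx : x ∉ Subgroup.center G) (hy : y ∉ Subgroup.center G),
      (commutingGraph G).dist ⟨x, hx⟩ ⟨y, hy⟩ = 8 := by
  refine ⟨H.x_not_mem_center, ?_, H.dist_eq rfl hy⟩
  rw [H.not_mem_center, hy]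
  intro h
  apply H.not_mem_center.1 H.x_not_mem_center
  rw [show x = g * (g⁻¹ * x * g) * g⁻¹ by group, h, mul_one, mul_inv_cancel]

theorem ediam_eq : (commutingGraph G).ediam = 8 := by
  refine le_antisymm (SimpleGraph.ediam_le_of_edist_le H.edist_le) ?_
  obtain ⟨hx, hy, h⟩ := H.exists_dist_eq rfl
  have h1 := SimpleGraph.edist_le_ediam (G := commutingGraph G) (u := ⟨x, hx⟩)
    (v := ⟨g⁻¹ * x * g, hy⟩)
  rw [← (H.connected _ _).coe_dist_eq_edist, h] at h1
  exact_mod_cast h1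

end Distance

end IsConfiguration

/-! ### Coordinates on F, the torus action and the field automorphism -/

section Matrices

variable {K : Type*} [Field K]

theorem mat_diagSp (d e : Kˣ) : mat (diagSp d e) =
    Matrix.diagonal ![(d : K), (e : K), ((e⁻¹ : Kˣ) : K), ((d⁻¹ : Kˣ) : K)] := rfl

theorem diagSp_mul (d e d' e' : Kˣ) :
    diagSp d e * diagSp d' e' = diagSp (d * d') (e * e') := by
  apply mat_injective
  rw [mat_mul, mat_diagSp, mat_diagSp, mat_diagSp, Matrix.diagonal_mul_diagonal]
  congr 1
  funext i
  fin_cases i <;> simp [mul_comm]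

/-- The diagonal torus of the symplectic group. -/
def diagHom (K : Type*) [Field K] : Kˣ × Kˣ →* Sp4 K :=
  MonoidHom.mk' (fun u => diagSp u.1 u.2) fun u v => (diagSp_mul u.1 u.2 v.1 v.2).symm

theorem diagHom_apply (d e : Kˣ) : diagHom K (d, e) = diagSp d e := rfl

theorem diagHom_injective : Function.Injective (diagHom K) := by
  rintro ⟨d, e⟩ ⟨d', e'⟩ h
  have h1 : mat (diagSp d e) = mat (diagSp d' e') := congrArg mat h
  rw [mat_diagSp, mat_diagSp, Matrix.diagonal_injective.eq_iff] at h1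
  have h2 := congrFun h1 0
  have h3 := congrFun h1 1
  simp only [Matrix.cons_val_zero, Matrix.cons_val_one] at h2 h3
  rw [Units.ext h2, Units.ext h3]

theorem diagSp_pow (d e : Kˣ) (n : ℕ) : diagSp d e ^ n = diagSp (d ^ n) (e ^ n) := by
  rw [← diagHom_apply, ← map_pow, Prod.pow_mk, diagHom_apply]

theorem commute_diagSp (d e d' e' : Kˣ) : Commute (diagSp d e) (diagSp d' e') :=
  (Commute.all (d, e) (d', e')).map (diagHom K)

/-- The element of the unipotent subgroup with given coordinates. -/
def lowerSp (a s d c : K) : Sp4 K :=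
  Sp4.mk (lowerMat a (s * a + d) c d s) (lowerMat (-a) (-d) (-c) (-(s * a + d)) (-s))
    (lowerMat_mul_inv (by ring))
    (by
      ext i j
      fin_cases i <;> fin_cases j <;>
        simp [lowerMat, formJ, Matrix.mul_apply, Fin.sum_univ_four] <;> ring)

theorem mat_lowerSp (a s d c : K) : mat (lowerSp a s d c) = lowerMat a (s * a + d) c d s := rfl

theorem mem_unipotentF_iff {A : Sp4 K} :
    A ∈ unipotentF K ↔ ∃ a s d c : K, A = lowerSp a s d c := by
  constructor
  · rintro ⟨a, b, c, d, s, h, hA⟩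
    refine ⟨a, s, d, c, mat_injective ?_⟩
    rw [hA, mat_lowerSp, h, sub_add_cancel]
  · rintro ⟨a, s, d, c, rfl⟩
    exact ⟨a, s * a + d, c, d, s, by ring, rfl⟩

theorem lowerSp_inj {a s d c a' s' d' c' : K} :
    lowerSp a s d c = lowerSp a' s' d' c' ↔ a = a' ∧ s = s' ∧ d = d' ∧ c = c' := by
  constructor
  · intro h
    have h1 := congrArg mat h
    rw [mat_lowerSp, mat_lowerSp] at h1
    refine ⟨?_, ?_, ?_, ?_⟩
    · simpa [lowerMat] using congrFun (congrFun h1 1) 0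
    · simpa [lowerMat] using congrFun (congrFun h1 2) 1
    · simpa [lowerMat] using congrFun (congrFun h1 3) 1
    · simpa [lowerMat] using congrFun (congrFun h1 3) 0
  · rintro ⟨rfl, rfl, rfl, rfl⟩
    rfl

theorem lowerSp_zero : lowerSp (0 : K) 0 0 0 = 1 := by
  apply mat_injective
  rw [mat_one, mat_lowerSp]
  ext i j
  fin_cases i <;> fin_cases j <;> simp [lowerMat]

theorem lowerSp_mul (a s d c a' s' d' c' : K) :
    lowerSp a s d c * lowerSp a' s' d' c' =
      lowerSp (a + a') (s + s') (d - a * s' + d') (c + d * a' - a * (s' * a' + d') + c') := by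
  apply mat_injective
  rw [mat_mul, mat_lowerSp, mat_lowerSp, lowerMat_mul, mat_lowerSp, lowerMat, ← neg_add',
    show s * a + d + s * a' + (s' * a' + d') =
      (s + s') * (a + a') + (d - a * s' + d') by ring]

theorem gSp_eq : gSp K = lowerSp 0 1 1 0 := by
  apply mat_injective
  rw [mat_lowerSp]
  simp [gSp, Sp4.mk, mat, lowerMat]

/-- The four scaling factors are the positive roots of type C₂; all centralizers in F of torus
elements are read off from them. -/
theorem lowerSp_mul_diagSp (a s d c : K) (u v : Kˣ) :
    lowerSp a s d c * diagSp u v =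
      diagSp u v * lowerSp (a * (u * v⁻¹)) (s * (v * v)) (d * (u * v)) (c * (u * u)) := by
  have hu := u.ne_zero
  have hv := v.ne_zero
  apply mat_injective
  rw [mat_mul, mat_mul, mat_lowerSp, mat_lowerSp, mat_diagSp]
  ext i j
  rw [Matrix.mul_diagonal, Matrix.diagonal_mul]
  fin_cases i <;> fin_cases j <;> simp [lowerMat] <;> field_simp

theorem commute_lowerSp_diagSp_iff {a s d c : K} {u v : Kˣ} :
    Commute (lowerSp a s d c) (diagSp u v) ↔
      a * (u * v⁻¹) = a ∧ s * (v * v) = s ∧ d * (u * v) = d ∧ c * (u * u) = c := by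
  rw [commute_iff_eq, lowerSp_mul_diagSp, mul_right_inj, lowerSp_inj]

theorem mat_entrywise (σ : RingAut K) (A : Sp4 K) : mat (entrywise σ A) = (mat A).map σ := rfl

theorem entrywise_lowerSp (σ : RingAut K) (a s d c : K) :
    entrywise σ (lowerSp a s d c) = lowerSp (σ a) (σ s) (σ d) (σ c) := by
  apply mat_injective
  rw [mat_entrywise, mat_lowerSp, mat_lowerSp]
  ext i j
  fin_cases i <;> fin_cases j <;> simp [lowerMat]

theorem entrywise_diagSp (σ : RingAut K) (q : ℕ) (hσ : ∀ a, σ a = a ^ q) (d e : Kˣ) :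
    entrywise σ (diagSp d e) = diagSp (d ^ q) (e ^ q) := by
  apply mat_injective
  rw [mat_entrywise, mat_diagSp, mat_diagSp, Matrix.diagonal_map (map_zero σ)]
  congr 1
  funext i
  fin_cases i <;> simp [hσ]

theorem card_unipotentF : Nat.card (unipotentF K) = Nat.card K ^ 4 := by
  let φ : K × K × K × K → unipotentF K := fun v =>
    ⟨lowerSp v.1 v.2.1 v.2.2.1 v.2.2.2, mem_unipotentF_iff.2 ⟨_, _, _, _, rfl⟩⟩
  have hφ : Function.Bijective φ := by
    constructor
    · rintro ⟨a, s, d, c⟩ ⟨a', s', d', c'⟩ h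
      obtain ⟨rfl, rfl, rfl, rfl⟩ := lowerSp_inj.1 (congrArg Subtype.val h)
      rfl
    · rintro ⟨A, hA⟩
      obtain ⟨a, s, d, c, rfl⟩ := mem_unipotentF_iff.1 hA
      exact ⟨(a, s, d, c), rfl⟩
  rw [← Nat.card_congr (Equiv.ofBijective φ hφ)]
  simp only [Nat.card_prod]
  ring

theorem card_subF (β : RingAut K) : Nat.card (subF β) = Nat.card K ^ 4 := by
  rw [← card_unipotentF, subF]
  exact (Nat.card_congr ((unipotentF K).equivMapOfInjective _
    SemidirectProduct.inl_injective).toEquiv).symm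

theorem mem_subF_iff {β : RingAut K} {A : Ambient β} :
    A ∈ subF β ↔ ∃ a s d c : K, A = SemidirectProduct.inl (lowerSp a s d c) := by
  constructor
  · rintro ⟨B, hB, rfl⟩
    obtain ⟨a, s, d, c, rfl⟩ := mem_unipotentF_iff.1 hB
    exact ⟨a, s, d, c, rfl⟩
  · rintro ⟨a, s, d, c, rfl⟩
    exact ⟨_, mem_unipotentF_iff.2 ⟨_, _, _, _, rfl⟩, rfl⟩

theorem commute_inl_iff {β : RingAut K} {A B : Sp4 K} :
    Commute (SemidirectProduct.inl A : Ambient β) (SemidirectProduct.inl B) ↔ Commute A B :=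
  commute_map_iff SemidirectProduct.inl_injective

theorem inl_mul_betaElt (β : RingAut K) (h : Sp4 K) :
    SemidirectProduct.inl h * betaElt β = betaElt β * SemidirectProduct.inl (entrywise β h) := by
  rw [← betaElt_conj]
  group

theorem inl_mul_xElt (β : RingAut K) (d e : Kˣ) (h h' : Sp4 K)
    (hh : h * diagSp d e = diagSp d e * h') :
    SemidirectProduct.inl h * xElt β d e =
      xElt β d e * SemidirectProduct.inl (entrywise β h') := by
  rw [xElt, ← mul_assoc, ← map_mul, hh, map_mul, mul_assoc, inl_mul_betaElt, mul_assoc]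

theorem xElt_mem_normalizer [Finite K] (β : RingAut K) (d e : Kˣ) :
    xElt β d e ∈ Subgroup.normalizer (subF β : Set (Ambient β)) := by
  have : Finite (subF β) := Nat.finite_of_card_ne_zero (by
    rw [card_subF]; exact pow_ne_zero _ Nat.card_pos.ne')
  rw [← inv_mem_iff]
  -- As F is finite, one inclusion suffices; passing to the inverse matches the direction in which
  -- `inl_mul_xElt` moves x.
  refine Subgroup.mem_normalizer_fintype fun A hA => ?_
  obtain ⟨a, s, b, c, rfl⟩ := mem_subF_iff.1 hA
  rw [inv_inv, mul_assoc, inl_mul_xElt β d e _ _ (lowerSp_mul_diagSp a s b c d e),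
    inv_mul_cancel_left, entrywise_lowerSp]
  exact mem_subF_iff.2 ⟨_, _, _, _, rfl⟩

theorem cElt_mem_normalizer [Finite K] (β : RingAut K) (f : Kˣ) :
    cElt β f ∈ Subgroup.normalizer (subF β : Set (Ambient β)) := by
  have : Finite (subF β) := Nat.finite_of_card_ne_zero (by
    rw [card_subF]; exact pow_ne_zero _ Nat.card_pos.ne')
  rw [← inv_mem_iff]
  refine Subgroup.mem_normalizer_fintype fun A hA => ?_
  obtain ⟨a, s, b, c, rfl⟩ := mem_subF_iff.1 hA
  rw [inv_inv, mul_assoc, cElt, ← map_mul, lowerSp_mul_diagSp, map_mul, inv_mul_cancel_left]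
  exact mem_subF_iff.2 ⟨_, _, _, _, rfl⟩

theorem subD_le_normalizer [Finite K] (β : RingAut K) (d e f : Kˣ) :
    subD β d e f ≤ Subgroup.normalizer (subF β : Set (Ambient β)) := by
  rw [subD, Subgroup.closure_le]
  rintro _ (rfl | rfl)
  · exact xElt_mem_normalizer β d e
  · exact cElt_mem_normalizer β f

theorem coe_groupG [Finite K] (β : RingAut K) (d e f : Kˣ) :
    (groupG β d e f : Set (Ambient β)) = {w | ∃ u ∈ subF β, ∃ v ∈ subD β d e f, w = u * v} := by
  rw [groupG, Subgroup.coe_mul_of_right_le_normalizer_left _ _ (subD_le_normalizer β d e f)]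
  ext w
  simp only [Set.mem_mul, SetLike.mem_coe, Set.mem_ofPred_eq]
  exact ⟨fun ⟨u, hu, v, hv, h⟩ => ⟨u, hu, v, hv, h.symm⟩,
    fun ⟨u, hu, v, hv, h⟩ => ⟨u, hu, v, hv, h.symm⟩⟩

theorem orderOf_cElt (β : RingAut K) (f : Kˣ) : orderOf (cElt β f) = orderOf f :=
  orderOf_injective (((SemidirectProduct.inl : Sp4 K →* Ambient β).comp (diagHom K)).comp
    ((MonoidHom.id Kˣ).prod (MonoidHom.id Kˣ)))
    ((SemidirectProduct.inl_injective.comp diagHom_injective).comp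
      fun _ _ h => congrArg Prod.fst h) f

/-- Moving each β to the left raises the diagonal entries it passes to the power q. -/
theorem xElt_pow (β : RingAut K) (q : ℕ) (hβ : ∀ a, β a = a ^ q) (d e : Kˣ) (k : ℕ) :
    xElt β d e ^ k = betaElt β ^ k * SemidirectProduct.inl
      (diagSp (d ^ ∑ i ∈ Finset.range k, q ^ (i + 1)) (e ^ ∑ i ∈ Finset.range k, q ^ (i + 1))) := by
  induction k with
  | zero => simp [← diagHom_apply, Prod.mk_one_one]
  | succ k ih =>
    rw [pow_succ, ih, mul_assoc, xElt, ← mul_assoc (SemidirectProduct.inl _), ← map_mul, diagSp_mul,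
      inl_mul_betaElt, entrywise_diagSp β q hβ, ← mul_assoc, ← pow_succ, ← pow_succ, ← pow_succ,
      ← pow_mul, ← pow_mul, Finset.sum_range_succ', add_mul, Finset.sum_mul]
    simp [pow_succ]

theorem cElt_mul_xElt (β : RingAut K) (q : ℕ) (hβ : ∀ a, β a = a ^ q) (d e f : Kˣ) :
    cElt β f * xElt β d e = xElt β d e * cElt β f ^ q := by
  rw [cElt, inl_mul_xElt β d e _ _ (commute_diagSp f f d e), entrywise_diagSp β q hβ, ← map_pow,
    diagSp_pow]

end Matrices

/-! ### Congruences modulo r ^ 2 -/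

section Numbers

theorem pow_modEq_sq {q r : ℕ} (hq : 0 < q) (hr : r ∣ q - 1) :
    ∃ m, ∀ j, q ^ j ≡ 1 + j * (m * r) [MOD r ^ 2] := by
  obtain ⟨m, hm⟩ := hr
  refine ⟨m, fun j => ?_⟩
  have hq' : q = 1 + m * r := by rw [mul_comm m, ← hm]; omega
  induction j with
  | zero => simp [Nat.ModEq.refl]
  | succ j ih =>
    rw [pow_succ]
    refine (ih.mul_right q).trans ?_
    rw [hq', show (1 + j * (m * r)) * (1 + m * r) =
      (1 + (j + 1) * (m * r)) + r ^ 2 * (j * m * m) by ring]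
    simp [Nat.ModEq]

/-- With q = 1 + m r the sum is r + m r · r (r + 1) / 2 modulo r ^ 2, and r + 1 is even. This is
what makes x ^ r equal to z ^ r. -/
theorem sum_pow_modEq {q r : ℕ} (hq : 0 < q) (hodd : Odd r) (hr : r ∣ q - 1) :
    ∑ i ∈ Finset.range r, q ^ (i + 1) ≡ r [MOD r ^ 2] := by
  obtain ⟨m, hm⟩ := pow_modEq_sq hq hr
  have h1 : ∑ i ∈ Finset.range r, q ^ (i + 1) ≡
      ∑ i ∈ Finset.range r, (1 + (i + 1) * (m * r)) [MOD r ^ 2] :=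
    Nat.ModEq.sum fun i _ => hm (i + 1)
  refine h1.trans ?_
  obtain ⟨s, hs⟩ := hodd
  have h2 : ∑ i ∈ Finset.range r, (i + 1) = r * (s + 1) := by
    have h3 := Finset.sum_range_id_mul_two (r + 1)
    rw [Finset.sum_range_succ'] at h3
    have h4 : (r + 1) * r = r * (s + 1) * 2 := by nth_rw 1 [hs]; ring
    simp only [add_zero, Nat.add_sub_cancel, h4] at h3
    exact Nat.eq_of_mul_eq_mul_right two_pos h3
  rw [Finset.sum_add_distrib, ← Finset.sum_mul, h2]
  simp only [Finset.sum_const, Finset.card_range, smul_eq_mul, mul_one]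
  rw [show r + r * (s + 1) * (m * r) = r + r ^ 2 * ((s + 1) * m) by ring]
  simp [Nat.ModEq]

variable {q r t : ℕ}

theorem IsParameters.odd_r (h : IsParameters q r t) : Odd r :=
  h.prime_r.odd_of_ne_two (by have := h.five_le; omega)

theorem IsParameters.sq_dvd (h : IsParameters q r t) (hq : 0 < q) : r ^ 2 ∣ q ^ r - 1 := by
  obtain ⟨m, hm⟩ := pow_modEq_sq hq h.r_dvd
  refine (Nat.modEq_iff_dvd' (Nat.one_le_pow _ _ hq)).1 ((hm r).trans ?_).symm
  rw [show 1 + r * (m * r) = 1 + r ^ 2 * m by ring]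
  simp [Nat.ModEq]

theorem IsParameters.t_dvd_pow_sub (h : IsParameters q r t) : t ∣ q ^ r - 1 :=
  h.t_dvd.trans (Nat.div_dvd_of_dvd (by simpa using Nat.sub_dvd_pow_sub_pow q 1 r))

theorem IsParameters.r_ne_t (h : IsParameters q r t) : r ≠ t := by
  rintro rfl
  exact h.t_not_dvd h.r_dvd

theorem not_dvd_of_prime_of_dvd_pow_sub_one {p n : ℕ} (hp : p.Prime) (hn : n ≠ 0) :
    ¬ p ∣ p ^ n - 1 := by
  intro h
  have h1 : p ∣ p ^ n := dvd_pow_self p hn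
  have h2 := (Nat.dvd_sub_iff_right (Nat.one_le_pow n p hp.pos) h1).1 h
  exact hp.one_lt.ne' (Nat.dvd_one.1 h2)

end Numbers

/-! ### Existence and properties of the field elements -/

section Admissible

variable {K : Type*} [Field K]

theorem exists_isAdmissible [Finite K] {q r t : ℕ} (hP : IsParameters q r t) (hq : 0 < q)
    (hK : Nat.card K = q ^ r) : ∃ d e f : Kˣ, IsAdmissible r t d e f := by
  obtain ⟨u, hu⟩ := IsCyclic.exists_ofOrder_eq_natCard (α := Kˣ)
  rw [Nat.card_units, hK] at hu
  have hpos : 0 < orderOf u := orderOf_pos u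
  have key : ∀ m, m ∣ q ^ r - 1 → ∃ v : Kˣ, orderOf v = m := fun m hm =>
    ⟨u ^ (orderOf u / m), orderOf_pow_orderOf_div hpos.ne' (hu ▸ hm)⟩
  obtain ⟨d, hd⟩ := key _ (hP.sq_dvd hq)
  obtain ⟨f, hf⟩ := key _ hP.t_dvd_pow_sub
  have h5 := hP.five_le
  have hdr : orderOf (d ^ r) = r := by
    rw [orderOf_pow_of_dvd hP.prime_r.ne_zero (by rw [hd]; exact dvd_pow_self _ two_ne_zero),
      hd, pow_two, Nat.mul_div_cancel _ hP.prime_r.pos]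
  -- For w = d ^ r of order r ≥ 5, the elements w, w⁻¹, w², w⁻² are distinct: a coincidence would
  -- give w ^ i = 1 with 1 ≤ i ≤ 4.
  refine ⟨d, d ^ 2, f, hd, ?_, ?_, hf⟩
  · rw [Nat.Coprime.orderOf_pow, hd]
    rw [hd]
    exact (hP.odd_r.coprime_two_right).pow_left 2
  · rw [← pow_mul, mul_comm 2, pow_mul]
    set w := d ^ r
    have hne : ∀ i, 0 < i → i < 5 → w ^ i ≠ 1 := fun i h0 hi h =>
      absurd (Nat.le_of_dvd h0 (orderOf_dvd_of_pow_eq_one h)) (by omega)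
    have h1 : w ≠ w⁻¹ := fun h => hne 2 (by norm_num) (by norm_num) (by
      rw [pow_two]; nth_rw 1 [h]; exact inv_mul_cancel w)
    have h2 : w ≠ w ^ 2 := fun h => hne 1 (by norm_num) (by norm_num) (by
      rw [pow_two] at h; rw [pow_one]; exact left_eq_mul.1 h)
    have h3 : w ≠ (w ^ 2)⁻¹ := fun h => hne 3 (by norm_num) (by norm_num) (by
      rw [pow_succ']; nth_rw 1 [h]; exact inv_mul_cancel _)
    have h4 : w⁻¹ ≠ w ^ 2 := fun h => h3 (by rw [← h, inv_inv])
    have h5 : w⁻¹ ≠ (w ^ 2)⁻¹ := fun h => h2 (inv_injective h)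
    have h6 : w ^ 2 ≠ (w ^ 2)⁻¹ := fun h => hne 4 (by norm_num) (by norm_num) (by
      rw [show 4 = 2 + 2 from rfl, pow_add]; nth_rw 1 [h]; exact inv_mul_cancel _)
    rw [Set.ncard_insert_of_notMem (by simp [h1, h2, h3]),
      Set.ncard_insert_of_notMem (by simp only [Set.mem_insert_iff, Set.mem_singleton_iff]; tauto),
      Set.ncard_pair h6]

theorem IsAdmissible.pow_ne {r t : ℕ} {d e f : Kˣ} (h : IsAdmissible r t d e f) :
    d ^ r ≠ e ^ r ∧ d ^ r ≠ (e ^ r)⁻¹ ∧ d ^ r ≠ (d ^ r)⁻¹ ∧ e ^ r ≠ (e ^ r)⁻¹ := by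
  have h4 := h.four
  have le3 : ∀ a b c : Kˣ, ({a, b, c} : Set Kˣ).ncard ≤ 3 := fun a b c => by
    have h1 := Set.ncard_insert_le a {b, c}
    have h2 := Set.ncard_insert_le b {c}
    rw [Set.ncard_singleton] at h2
    omega
  have key : ∀ {a b c : Kˣ}, ({d ^ r, (d ^ r)⁻¹, e ^ r, (e ^ r)⁻¹} : Set Kˣ) = {a, b, c} →
      False := fun {a b c} h' => by
    have := le3 a b c
    rw [← h', h4] at this
    omega
  refine ⟨fun h' => ?_, fun h' => ?_, fun h' => ?_, fun h' => ?_⟩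
  · refine key (a := e ^ r) (b := (e ^ r)⁻¹) (c := (e ^ r)⁻¹) ?_
    rw [h']
    ext y
    simp only [Set.mem_insert_iff, Set.mem_singleton_iff]
    tauto
  · refine key (a := e ^ r) (b := (e ^ r)⁻¹) (c := (e ^ r)⁻¹) ?_
    rw [h', inv_inv]
    ext y
    simp only [Set.mem_insert_iff, Set.mem_singleton_iff]
    tauto
  · refine key (a := d ^ r) (b := e ^ r) (c := (e ^ r)⁻¹) ?_
    rw [← h']
    simp
  · refine key (a := d ^ r) (b := (d ^ r)⁻¹) (c := e ^ r) ?_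
    rw [← h']
    simp

end Admissible

/-! ### The matrix groups satisfy `IsConfiguration` -/

section Family

variable {K : Type*} [Field K] [Finite K] {p n r t : ℕ} {β : RingAut K} {d e f : Kˣ}

theorem orderOf_eq_of_forall_pow (hP : IsParameters (p ^ n) r t)
    (hK : Nat.card K = (p ^ n) ^ r) (hβ : ∀ a, β a = a ^ p ^ n) (hf : orderOf f = t) :
    orderOf β = r := by
  have := Fact.mk hP.prime_r
  have hpow : ∀ k (a : K), (β ^ k) a = a ^ (p ^ n) ^ k := by
    intro k
    induction k with
    | zero => simp
    | succ k ih =>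
      intro a
      rw [pow_succ, RingAut.mul_apply, hβ, ih, ← pow_mul, ← pow_succ']
  refine orderOf_eq_prime ?_ ?_
  · ext a
    have : Fintype K := Fintype.ofFinite K
    rw [hpow, ← hK, Nat.card_eq_fintype_card, FiniteField.pow_card]
    rfl
  · rintro rfl
    -- If β were trivial it would fix f, whose order t does not divide q - 1.
    have h1 : f ^ p ^ n = f := Units.ext (by simpa using (hβ f).symm)
    apply hP.t_not_dvd
    rw [← hf]
    refine orderOf_dvd_of_pow_eq_one ?_
    rcases Nat.eq_zero_or_pos (p ^ n) with h0 | h0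
    · rw [h0]; simp
    · rw [← Nat.sub_add_cancel h0, pow_succ] at h1
      exact mul_eq_right.1 h1

omit [Finite K] in
theorem xElt_pow_r (hq : 0 < p ^ n) (hP : IsParameters (p ^ n) r t) (hβ : ∀ a, β a = a ^ p ^ n)
    (hr : orderOf β = r) (h : IsAdmissible r t d e f) :
    xElt β d e ^ r = SemidirectProduct.inl (diagSp (d ^ r) (e ^ r)) := by
  have h1 : betaElt β ^ r = 1 := by
    rw [betaElt, ← map_pow]
    have : (⟨β, Subgroup.mem_zpowers β⟩ : Subgroup.zpowers β) ^ r = 1 :=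
      Subtype.ext (by rw [← hr]; exact pow_orderOf_eq_one β)
    rw [this, map_one]
  have h2 := sum_pow_modEq hq hP.odd_r hP.r_dvd
  have hd : d ^ (∑ i ∈ Finset.range r, (p ^ n) ^ (i + 1)) = d ^ r :=
    pow_eq_pow_iff_modEq.2 (by rwa [h.order_d])
  have he : e ^ (∑ i ∈ Finset.range r, (p ^ n) ^ (i + 1)) = e ^ r :=
    pow_eq_pow_iff_modEq.2 (by rwa [h.order_e])
  rw [xElt_pow β (p ^ n) hβ, h1, one_mul, hd, he]

omit [Finite K] in
theorem orderOf_xElt (hq : 0 < p ^ n) (hP : IsParameters (p ^ n) r t)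
    (hβ : ∀ a, β a = a ^ p ^ n) (hr : orderOf β = r) (h : IsAdmissible r t d e f) :
    orderOf (xElt β d e) = r ^ 2 := by
  have := Fact.mk hP.prime_r
  have hx := xElt_pow_r hq hP hβ hr h
  refine orderOf_eq_prime_pow (n := 1) ?_ ?_
  · rw [pow_one, hx]
    intro h1
    have h2 : diagHom K (d ^ r, e ^ r) = 1 :=
      SemidirectProduct.inl_injective (h1.trans (map_one _).symm)
    have h3 := congrArg Prod.fst (diagHom_injective (h2.trans (map_one _).symm))
    have h4 : d ^ r = 1 := h3
    have h5 := h.pow_ne.2.2.1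
    rw [h4] at h5
    simp at h5
  · rw [pow_succ, pow_one, pow_mul, hx, ← map_pow, diagSp_pow, ← pow_mul, ← pow_mul, ← pow_two,
      ← h.order_d, pow_orderOf_eq_one, h.order_d, ← h.order_e, pow_orderOf_eq_one]
    exact (congrArg _ (map_one (diagHom K))).trans (map_one _)

/-- The element `c` of `G`. -/
def cG (β : RingAut K) (d e f : Kˣ) : groupG β d e f :=
  ⟨cElt β f, (le_sup_right : subD β d e f ≤ groupG β d e f)
    (Subgroup.subset_closure (Set.mem_insert_of_mem _ rfl))⟩

omit [Finite K] in
theorem commute_coe_iff {G : Type*} [Group G] {S : Subgroup G} {a b : S} :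
    Commute (a : G) b ↔ Commute a b :=
  commute_map_iff (f := S.subtype) S.subtype_injective

omit [Finite K] in
theorem ne_one_of_order_prime_ne_two {t : ℕ} (ht : t.Prime) (h2 : t ≠ 2) {f : Kˣ}
    (hf : orderOf f = t) : (f * f : K) ≠ 1 := by
  intro h
  have h1 : f ^ 2 = 1 := Units.ext (by simpa [pow_two] using h)
  rw [← orderOf_dvd_iff_pow_eq_one, hf] at h1
  exact h2 ((Nat.prime_dvd_prime_iff_eq ht Nat.prime_two).1 h1)

omit [Finite K] in
theorem commute_lowerSp_cElt_iff (hf : (f * f : K) ≠ 1) {a s b c : K} :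
    Commute (SemidirectProduct.inl (lowerSp a s b c)) (cElt β f) ↔ s = 0 ∧ b = 0 ∧ c = 0 := by
  have key : ∀ y : K, y * (f * f) = y ↔ y = 0 := fun y => by
    rw [mul_right_eq_self₀, or_iff_right hf]
  rw [cElt, commute_inl_iff, commute_lowerSp_diagSp_iff, key, key, key]
  simp

theorem isConfiguration [Fact p.Prime] [CharP K p] (hp : p ≠ 2) (hn : 0 < n)
    (hP : IsParameters (p ^ n) r t) (hK : Nat.card K = (p ^ n) ^ r)
    (hβ : ∀ a, β a = a ^ p ^ n) (h : IsAdmissible r t d e f) :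
    IsConfiguration ((subF β).subgroupOf (groupG β d e f)) (xG β d e f) (cG β d e f) (gG β d e f)
      p r t (p ^ n) := by
  have hpp : p.Prime := Fact.out
  have hq : 0 < p ^ n := pow_pos hpp.pos n
  have hr := orderOf_eq_of_forall_pow hP hK hβ h.order_f
  have hqr : (p ^ n) ^ r = p ^ (n * r) := (pow_mul p n r).symm
  have hFG : subF β ≤ groupG β d e f := le_sup_left
  have two_ne : (2 : K) ≠ 0 := Ring.two_ne_zero (by rwa [ringChar.eq K p])
  have ht2 : t ≠ 2 := by
    rintro rfl
    have : Odd (p ^ n) := (hpp.odd_of_ne_two hp).pow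
    exact hP.t_not_dvd (Nat.Odd.sub_odd this odd_one).two_dvd
  have hff := ne_one_of_order_prime_ne_two hP.prime_t ht2 h.order_f
  have hcardF : Nat.card ((subF β).subgroupOf (groupG β d e f)) = p ^ (n * r * 4) := by
    rw [Nat.card_congr (Subgroup.subgroupOfEquivOfLe hFG).toEquiv, card_subF, hK, hqr, ← pow_mul]
  obtain ⟨n₁, n₂, n₃, n₄⟩ := h.pow_ne
  refine
    { prime_p := hpp
      prime_r := hP.prime_r
      prime_t := hP.prime_t
      p_ne_r := ?_
      p_ne_t := ?_
      r_ne_t := hP.r_ne_t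
      normal := ?_
      finite := Nat.finite_of_card_ne_zero (by rw [hcardF]; exact pow_ne_zero _ hpp.ne_zero)
      isPGroup := IsPGroup.of_card hcardF
      order_x := ?_
      order_c := ?_
      conj_c := Subtype.ext (cElt_mul_xElt β (p ^ n) hβ d e f)
      commute_c := ?_
      not_commute_c := ?_
      eq_one_of_commute := ?_
      g_mem := ?_
      not_commute_g := ?_
      not_commute_conj := ?_
      exists_commute_c := ?_
      exists_central := ?_
      eq_mul := ?_ }
  · rintro rfl
    exact not_dvd_of_prime_of_dvd_pow_sub_one hpp hn.ne' hP.r_dvd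
  · rintro rfl
    have := hP.t_dvd_pow_sub
    rw [hqr] at this
    exact not_dvd_of_prime_of_dvd_pow_sub_one hpp (mul_pos hn hP.prime_r.pos).ne' this
  · rw [Subgroup.normal_subgroupOf_iff_le_normalizer hFG]
    exact sup_le Subgroup.le_normalizer (subD_le_normalizer β d e f)
  · rw [← Subgroup.orderOf_coe]
    exact orderOf_xElt hq hP hβ hr h
  · rw [← Subgroup.orderOf_coe, ← h.order_f]
    exact orderOf_cElt β f
  · rw [← commute_coe_iff]
    change Commute (cElt β f) (xElt β d e ^ r)
    rw [xElt_pow_r hq hP hβ hr h, cElt, commute_inl_iff]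
    exact commute_diagSp _ _ _ _
  · rw [← commute_coe_iff]
    intro hcomm
    have h1 : xElt β d e * cElt β f ^ p ^ n = xElt β d e * cElt β f :=
      (cElt_mul_xElt β (p ^ n) hβ d e f).symm.trans hcomm
    have h2 := mul_left_cancel h1
    rw [← Nat.sub_add_cancel hq, pow_succ, mul_eq_right] at h2
    apply hP.t_not_dvd
    rw [← h.order_f, ← orderOf_cElt β f]
    exact orderOf_dvd_of_pow_eq_one h2
  · intro u hu hcomm
    obtain ⟨a, s, b, c, hu⟩ := mem_subF_iff.1 (Subgroup.mem_subgroupOf.1 hu)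
    rw [← commute_coe_iff] at hcomm
    change Commute (u : Ambient β) (xElt β d e ^ r) at hcomm
    -- The four-element condition says exactly that no root is trivial on diag(d ^ r, e ^ r, ...).
    rw [xElt_pow_r hq hP hβ hr h, hu, commute_inl_iff, commute_lowerSp_diagSp_iff] at hcomm
    have key : ∀ {y : K} {v : Kˣ}, v ≠ 1 → y * v = y → y = 0 := fun {y v} hv hy => by
      by_contra hy0
      exact hv (Units.ext ((mul_eq_left₀ hy0).1 hy))
    obtain ⟨h1, h2, h3, h4⟩ := hcomm
    have e1 : a = 0 := key (v := d ^ r * (e ^ r)⁻¹) (by rwa [ne_eq, mul_inv_eq_one]) (by simpa using h1)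
    have e2 : s = 0 := key (v := e ^ r * e ^ r) (by rwa [ne_eq, mul_eq_one_iff_eq_inv])
      (by simpa using h2)
    have e3 : b = 0 := key (v := d ^ r * e ^ r) (by rwa [ne_eq, mul_eq_one_iff_eq_inv])
      (by simpa using h3)
    have e4 : c = 0 := key (v := d ^ r * d ^ r) (by rwa [ne_eq, mul_eq_one_iff_eq_inv])
      (by simpa using h4)
    apply Subtype.ext
    rw [hu, e1, e2, e3, e4, lowerSp_zero, map_one]
    rfl
  · exact Subgroup.mem_subgroupOf.2 ⟨gSp K, gSp_mem K, rfl⟩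
  · rw [← commute_coe_iff]
    change ¬ Commute (SemidirectProduct.inl (gSp K)) (cElt β f)
    rw [gSp_eq, commute_lowerSp_cElt_iff hff]
    simp
  · intro a ha b hb hac hbc ha1 hb1 hcomm
    obtain ⟨a₁, s₁, d₁, c₁, ha⟩ := mem_subF_iff.1 (Subgroup.mem_subgroupOf.1 ha)
    obtain ⟨a₂, s₂, d₂, c₂, hb⟩ := mem_subF_iff.1 (Subgroup.mem_subgroupOf.1 hb)
    rw [← commute_coe_iff] at hac hbc hcomm
    have hac : Commute (a : Ambient β) (cElt β f) := hac
    have hbc : Commute (b : Ambient β) (cElt β f) := hbc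
    have hcomm : Commute (a : Ambient β) ((gElt β)⁻¹ * (b : Ambient β) * gElt β) := hcomm
    rw [ha, commute_lowerSp_cElt_iff hff] at hac
    rw [hb, commute_lowerSp_cElt_iff hff] at hbc
    obtain ⟨rfl, rfl, rfl⟩ := hac
    obtain ⟨rfl, rfl, rfl⟩ := hbc
    have hconj : (gElt β)⁻¹ * (b : Ambient β) * gElt β =
        SemidirectProduct.inl (lowerSp a₂ 0 (-a₂) (-(2 * a₂))) := by
      rw [mul_assoc, inv_mul_eq_iff_eq_mul, hb, gElt, ← map_mul, ← map_mul, gSp_eq, lowerSp_mul,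
        lowerSp_mul]
      congr 2 <;> ring
    rw [ha, hconj, commute_inl_iff, commute_iff_eq, lowerSp_mul, lowerSp_mul, lowerSp_inj] at hcomm
    -- The two products differ only in the corner entry, by 2 a₁ a₂.
    have h1 : 2 * (a₁ * a₂) = 0 := by linear_combination hcomm.2.2.2
    rcases mul_eq_zero.1 ((mul_eq_zero.1 h1).resolve_left two_ne) with h0 | h0
    · apply ha1
      apply Subtype.ext
      rw [ha, h0, lowerSp_zero, map_one]
      rfl
    · apply hb1
      apply Subtype.ext
      rw [hb, h0, lowerSp_zero, map_one]
      rfl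
  · have hm : (SemidirectProduct.inl (lowerSp (1 : K) 0 0 0) : Ambient β) ∈ subF β :=
      mem_subF_iff.2 ⟨_, _, _, _, rfl⟩
    refine ⟨⟨_, hFG hm⟩, Subgroup.mem_subgroupOf.2 hm, fun h1 => ?_, ?_⟩
    · have h2 := SemidirectProduct.inl_injective ((congrArg Subtype.val h1).trans (map_one _).symm)
      rw [← lowerSp_zero, lowerSp_inj] at h2
      exact one_ne_zero h2.1
    · rw [← commute_coe_iff]
      exact (commute_lowerSp_cElt_iff hff).2 ⟨rfl, rfl, rfl⟩
  -- The corner coordinate, of root u², is the highest root subgroup and hence central in F.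
  · have hm : (SemidirectProduct.inl (lowerSp (0 : K) 0 0 1) : Ambient β) ∈ subF β :=
      mem_subF_iff.2 ⟨_, _, _, _, rfl⟩
    refine ⟨⟨_, hFG hm⟩, Subgroup.mem_subgroupOf.2 hm, fun h1 => ?_, fun u hu => ?_⟩
    · have h2 := SemidirectProduct.inl_injective ((congrArg Subtype.val h1).trans (map_one _).symm)
      rw [← lowerSp_zero, lowerSp_inj] at h2
      exact one_ne_zero h2.2.2.2
    · obtain ⟨a, s, b, c, hu⟩ := mem_subF_iff.1 (Subgroup.mem_subgroupOf.1 hu)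
      rw [← commute_coe_iff, hu, commute_inl_iff, commute_iff_eq, lowerSp_mul, lowerSp_mul]
      congr 1 <;> ring
  · rintro ⟨w, hw⟩
    have hw' : w ∈ (groupG β d e f : Set (Ambient β)) := hw
    rw [coe_groupG] at hw'
    obtain ⟨u, hu, v, hv, rfl⟩ := hw'
    -- The normal form x ^ j c ^ i carries membership in D from the ambient group to the closure
    -- taken inside G.
    obtain ⟨j, i, rfl⟩ := (mem_closure_pair_iff_pow (cElt_mul_xElt β (p ^ n) hβ d e f)
      (by rw [orderOf_xElt hq hP hβ hr h]; exact pow_pos hP.prime_r.pos 2)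
      (by rw [orderOf_cElt, h.order_f]; exact hP.prime_t.pos)).1 hv
    exact ⟨⟨u, hFG hu⟩, Subgroup.mem_subgroupOf.2 hu, xG β d e f ^ j * cG β d e f ^ i,
      mul_mem (pow_mem (Subgroup.subset_closure (by simp)) _)
        (pow_mem (Subgroup.subset_closure (by simp)) _), rfl⟩

theorem structure_subD [Fact p.Prime] [CharP K p] (hp : p ≠ 2) (hn : 0 < n)
    (hP : IsParameters (p ^ n) r t) (hK : Nat.card K = (p ^ n) ^ r)
    (hβ : ∀ a, β a = a ^ p ^ n) (h : IsAdmissible r t d e f) :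
    IsMetacyclic (subD β d e f) ∧ Nat.card (subD β d e f) = r ^ 2 * t ∧
      subD β d e f ≤ Subgroup.normalizer (subF β : Set (Ambient β)) ∧
      Disjoint (subF β) (subD β d e f) ∧
      (groupG β d e f : Set (Ambient β)) = {w | ∃ u ∈ subF β, ∃ v ∈ subD β d e f, w = u * v} := by
  have H := isConfiguration hp hn hP hK hβ h
  have hq : 0 < p ^ n := pow_pos (Fact.out : p.Prime).pos n
  have hr := orderOf_eq_of_forall_pow hP hK hβ h.order_f
  have hx := orderOf_xElt hq hP hβ hr h
  have hc : orderOf (cElt β f) = t := (orderOf_cElt β f).trans h.order_f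
  have hx0 : 0 < orderOf (xElt β d e) := by rw [hx]; exact pow_pos hP.prime_r.pos 2
  have hc0 : 0 < orderOf (cElt β f) := by rw [hc]; exact hP.prime_t.pos
  have hconj := cElt_mul_xElt β (p ^ n) hβ d e f
  have hcard : Nat.card (subD β d e f) = r ^ 2 * t := by
    rw [subD, card_closure_pair hconj hx0 hc0 ?_, hx, hc]
    rw [hx, hc]
    exact ((Nat.coprime_primes hP.prime_r hP.prime_t).2 hP.r_ne_t).pow_left 2
  refine ⟨isMetacyclic_closure_pair hconj hx0 hc0, hcard, subD_le_normalizer β d e f, ?_,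
    coe_groupG β d e f⟩
  refine Subgroup.disjoint_of_coprime_natCard ?_
  rw [hcard, card_subF, hK, ← pow_mul, ← pow_mul]
  exact H.coprime_p_card_D.pow_left _

theorem card_groupG [Fact p.Prime] [CharP K p] (hp : p ≠ 2) (hn : 0 < n)
    (hP : IsParameters (p ^ n) r t) (hK : Nat.card K = (p ^ n) ^ r)
    (hβ : ∀ a, β a = a ^ p ^ n) (h : IsAdmissible r t d e f) :
    Nat.card (groupG β d e f) = (p ^ n) ^ (4 * r) * r ^ 2 * t := by
  have hFG : subF β ≤ groupG β d e f := le_sup_left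
  rw [(isConfiguration hp hn hP hK hβ h).card_eq,
    Nat.card_congr (Subgroup.subgroupOfEquivOfLe hFG).toEquiv, card_subF, hK, ← pow_mul,
    mul_comm r, mul_assoc]

end Family

theorem isParameters_eleven : IsParameters 11 5 3221 where
  prime_r := by norm_num
  five_le := le_rfl
  r_dvd := by norm_num
  not_sq_dvd := by norm_num
  prime_t := by norm_num
  t_dvd := by norm_num
  t_not_dvd := by norm_num

end CommutingDiameter

theorem propositionM4 :
    -- the whole family; here `q = p ^ n` and the automorphism `β` is `a ↦ a ^ q`
    (∀ (p n r t : ℕ) [Fact p.Prime] (K : Type*) [Field K] [Finite K] [CharP K p],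
      p ≠ 2 → 0 < n → IsParameters (p ^ n) r t → Nat.card K = (p ^ n) ^ r →
      (∃ d e f : Kˣ, IsAdmissible r t d e f) ∧
      ∀ (β : RingAut K), β = iterateFrobeniusEquiv K p n →
      orderOf β = r ∧
      ∀ d e f : Kˣ, IsAdmissible r t d e f →
        -- the structure of `D` and of `G = F ⋊ D`
        (IsMetacyclic (subD β d e f) ∧ Nat.card (subD β d e f) = r ^ 2 * t ∧
          subD β d e f ≤ Subgroup.normalizer (subF β : Set (Ambient β)) ∧ Disjoint (subF β) (subD β d e f) ∧
          (groupG β d e f : Set (Ambient β)) =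
            {w | ∃ u ∈ subF β, ∃ v ∈ subD β d e f, w = u * v}) ∧
        -- `G` is a finite soluble group with trivial centre
        (Nat.card (groupG β d e f) = (p ^ n) ^ (4 * r) * r ^ 2 * t ∧
          Group.IsSolvable (groupG β d e f) ∧ Subgroup.center (groupG β d e f) = ⊥) ∧
        -- the vertices `x` and `y` are at distance `8`
        (∃ (hx : xG β d e f ∉ Subgroup.center (groupG β d e f))
            (hy : yG β d e f ∉ Subgroup.center (groupG β d e f)),
          (commutingGraph (groupG β d e f)).dist ⟨xG β d e f, hx⟩ ⟨yG β d e f, hy⟩ = 8) ∧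
        -- the commuting graph is connected of diameter `8`
        (commutingGraph (groupG β d e f)).Connected ∧
        (commutingGraph (groupG β d e f)).ediam = 8) ∧
    -- the explicit example `q = 11`, `r = 5`, `t = 3221`
    (IsParameters 11 5 3221 ∧
      ∀ (β : RingAut (GaloisField 11 5)), β = iterateFrobeniusEquiv (GaloisField 11 5) 11 1 →
      ∃ d e f : (GaloisField 11 5)ˣ, IsAdmissible 5 3221 d e f ∧
        Nat.card (groupG β d e f) = 11 ^ 20 * 5 ^ 2 * 3221 ∧
        Group.IsSolvable (groupG β d e f) ∧ Subgroup.center (groupG β d e f) = ⊥ ∧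
        (∃ (hx : xG β d e f ∉ Subgroup.center (groupG β d e f))
            (hy : yG β d e f ∉ Subgroup.center (groupG β d e f)),
          (commutingGraph (groupG β d e f)).dist ⟨xG β d e f, hx⟩ ⟨yG β d e f, hy⟩ = 8) ∧
        (commutingGraph (groupG β d e f)).Connected ∧
        (commutingGraph (groupG β d e f)).ediam = 8) := by
  refine ⟨?_, isParameters_eleven, ?_⟩
  · intro p n r t _ K _ _ _ hp hn hP hK
    have hq : 0 < p ^ n := pow_pos (Fact.out : p.Prime).pos n
    refine ⟨exists_isAdmissible hP hq hK, ?_⟩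
    rintro β rfl
    have hβ := iterateFrobeniusEquiv_def K p n
    -- The order of β is needed before any triple is given; an auxiliary element of order t shows
    -- that β is nontrivial.
    obtain ⟨d₀, e₀, f₀, h₀⟩ := exists_isAdmissible hP hq hK
    refine ⟨orderOf_eq_of_forall_pow hP hK hβ h₀.order_f, fun d e f h => ?_⟩
    have H := isConfiguration hp hn hP hK hβ h
    exact ⟨structure_subD hp hn hP hK hβ h,
      ⟨card_groupG hp hn hP hK hβ h, H.isSolvable, H.center_eq_bot⟩,
      H.exists_dist_eq rfl, H.connected, H.ediam_eq⟩
  · rintro β rfl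
    have hβ := iterateFrobeniusEquiv_def (GaloisField 11 5) 11 1
    have hP : IsParameters (11 ^ 1) 5 3221 := by rw [pow_one]; exact isParameters_eleven
    have hK : Nat.card (GaloisField 11 5) = (11 ^ 1) ^ 5 := by
      rw [GaloisField.card 11 5 (by norm_num), pow_one]
    obtain ⟨d, e, f, h⟩ := exists_isAdmissible hP (by norm_num) hK
    have H := isConfiguration (by norm_num) one_pos hP hK hβ h
    refine ⟨d, e, f, h, ?_, H.isSolvable, H.center_eq_bot, H.exists_dist_eq rfl, H.connected,
      H.ediam_eq⟩
    rw [card_groupG (by norm_num) one_pos hP hK hβ h, pow_one]
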